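/- **Theorem (Finslerian Bishop's Theorem).** Let $M$ be a smooth ($C^\infty$, Hausdorff, finite-dimensional) manifold without boundary and let $F\colon TM\to[0,+\infty)$ be a Finsler metric: $F$ is continuous, vanishes exactly on the zero section, satisfies $F(x,\lambda y)=\lambda F(x,y)$ for $\lambda>0$, $F^2$ is fiberwise $C^2$ on $TM\setminus 0$, and the fundamental tensor $g_{ij}(x,y)=\frac12\frac{\partial^2(F^2)}{\partial y^i\partial y^j}(x,y)$ is positive definite for every $(x,y)\in TM\setminus 0$. Assume that $g$ is $C^{1,1}_{\rm loc}$, i.e. in local coordinates its components are $C^1$ on $TM\setminus 0$ with locally Lipschitz derivatives. $F$ need not be reversible; let $\tilde F(x,y)=F(x,-y)$ be the reversed metric. Geodesics of $F$ are the $C^2$ curves which in local coordinates satisfy $\ddot\gamma^i+G^i(\gamma,\dot\gamma)=0$, where $$G^i(x,y)=g^{ij}(x,y)\Big(\tfrac12\,\partial_{y^jx^k}F^2(x,y)\,y^k-\tfrac12\,\partial_{x^j}F^2(x,y)\Big)\quad (y\neq0),\qquad G^i(x,0)=0 ,$$ and $\exp_p(v)=\gamma(1)$ if $\gamma$ is a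 geodesic of $F$ defined on an open interval containing $[0,1]$ with $\gamma(0)=p$, $\dot\gamma(0)=v$; $\widetilde{\exp}$ is the exponential map of $\tilde F$. Let $N\subset M$ be a $C^{2,1}_{\rm loc}$ embedded hypersurface: near each of its points, $N$ is the zero set of a $C^{2,1}_{\rm loc}$ real function $\phi$ with $d\phi\neq0$ on $N$, so that $T_xN=\ker d\phi(x)$. Let $p\in N$, let $U$ be an open neighborhood of $p$, and let an inner side of $N$ be chosen in $U$: a set $D$ (the inner domain) such that near every point of $U\cap N$ there is a function $\phi$ as above with $D=\{\phi>0\}$ near that point. Call $N$ infinitesimally convex at $x\in U\cap N$ if for one such $\phi$ near $x$ (it does not matter which) $$H_\phi(x,y)[y,y]=\frac{\partial^2\phi}{\partial x^i\partial x^j}(x)\,y^iy^j-\frac{\partial\phi}{\partial x^k}(x)\,G^k(x,y)\le 0\qquad\text{for all } y\in T_xN\setminus\{0\}.$$ If $N$ is infinitesimally convex at every point of $U\cap N$, then $N$ is locally convex at $p$, and in fact at every $q\in U\cap N$: there is a neighborhood $W$ of $0$ in $T_qM$ on which both $\exp_q$ and $\widetilde{\exp}_q$ are defined and such that $$\exp_q(v)\notin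 D\quad\text{and}\quad \widetilde{\exp}_q(v)\notin D\qquad\text{for all } v\in W\cap T_qN .$$ -/

import Mathlib

open Set Filter Topology
open scoped Manifold ContDiff

/-! ### Regularity classes -/

/-- `f` is of class `C^{k,1}_loc` on the (open) set `s`: it is `C^k` on `s` and its `k`-th
derivative is locally Lipschitz on `s`. -/
def IsCk1LocOn {E G : Type*} [NormedAddCommGroup E] [NormedSpace ℝ E]
    [NormedAddCommGroup G] [NormedSpace ℝ G] (k : ℕ) (f : E → G) (s : Set E) : Prop :=
  ContDiffOn ℝ k f s ∧ LocallyLipschitzOn s (iteratedFDeriv ℝ k f)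

namespace Finsler

noncomputable section

variable {n : ℕ} {M : Type*} [TopologicalSpace M] [ChartedSpace (EuclideanSpace ℝ (Fin n)) M]

/-! ### Finsler metrics in coordinates

Functions on the tangent bundle `TM` are written as `F : (x : M) → TangentSpace (𝓡 n) x → ℝ`.
A chart `e` of `M` gives coordinates `(x, y)` on the tangent bundle over `e.source`, with
`x ∈ e.target` and `y ∈ ℝⁿ`. -/

/-- The function `F²` read in the coordinates `(x, y)` of the tangent bundle given by `e`. -/
def sqIn (F : (x : M) → TangentSpace (𝓡 n) x → ℝ)
    (e : OpenPartialHomeomorph M (EuclideanSpace ℝ (Fin n)))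
    (x y : EuclideanSpace ℝ (Fin n)) : ℝ :=
  F (e.symm x) (mfderiv (𝓡 n) (𝓡 n) e.symm x y) ^ 2

/-- The `i`-th standard basis vector of `ℝⁿ`. -/
abbrev basisVec (i : Fin n) : EuclideanSpace ℝ (Fin n) := EuclideanSpace.single i 1

/-- The partial derivative `∂F²/∂yʲ` at `(x, y)`. -/
def dySq (F : (x : M) → TangentSpace (𝓡 n) x → ℝ)
    (e : OpenPartialHomeomorph M (EuclideanSpace ℝ (Fin n)))
    (j : Fin n) (x y : EuclideanSpace ℝ (Fin n)) : ℝ :=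
  fderiv ℝ (fun y' => sqIn F e x y') y (basisVec j)

/-- The partial derivative `∂F²/∂xʲ` at `(x, y)`. -/
def dxSq (F : (x : M) → TangentSpace (𝓡 n) x → ℝ)
    (e : OpenPartialHomeomorph M (EuclideanSpace ℝ (Fin n)))
    (j : Fin n) (x y : EuclideanSpace ℝ (Fin n)) : ℝ :=
  fderiv ℝ (fun x' => sqIn F e x' y) x (basisVec j)

/-- The mixed partial derivative `∂²F²/∂xᵏ∂yʲ` at `(x, y)`. -/
def dxdySq (F : (x : M) → TangentSpace (𝓡 n) x → ℝ)
    (e : OpenPartialHomeomorph M (EuclideanSpace ℝ (Fin n)))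
    (k j : Fin n) (x y : EuclideanSpace ℝ (Fin n)) : ℝ :=
  fderiv ℝ (fun x' => dySq F e j x' y) x (basisVec k)

/-- The matrix `g(x, y) = [½ ∂²F²/∂yⁱ∂yʲ (x, y)]` of the fundamental tensor in the chart `e`. -/
def fundamentalMatrix (F : (x : M) → TangentSpace (𝓡 n) x → ℝ)
    (e : OpenPartialHomeomorph M (EuclideanSpace ℝ (Fin n)))
    (x y : EuclideanSpace ℝ (Fin n)) : Matrix (Fin n) (Fin n) ℝ :=
  Matrix.of fun i j => (1 / 2 : ℝ) * fderiv ℝ (fun y' => dySq F e j x y') y (basisVec i)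

/-- `F` is a Finsler metric on `M`: continuous on `TM`, non-negative, vanishing exactly on the zero
section, fiberwise positively homogeneous of degree one, and such that off the zero section `F²` is
fiberwise `C²` with positive definite fundamental tensor.  The joint regularity of the fundamental
tensor is the separate condition `HasC11FundamentalTensor`. -/
structure IsFinslerMetric [IsManifold (𝓡 n) ∞ M]
    (F : (x : M) → TangentSpace (𝓡 n) x → ℝ) : Prop where
  continuous : Continuous fun v : TangentBundle (𝓡 n) M => F v.proj v.snd
  nonneg : ∀ x y, 0 ≤ F x y
  eq_zero_iff : ∀ x y, F x y = 0 ↔ y = 0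
  pos_homogeneous : ∀ x y (c : ℝ), 0 < c → F x (c • y) = c * F x y
  fiberwise_contDiff : ∀ e ∈ atlas (EuclideanSpace ℝ (Fin n)) M, ∀ x ∈ e.target,
    ContDiffOn ℝ 2 (fun y => sqIn F e x y) {0}ᶜ
  posDef : ∀ e ∈ atlas (EuclideanSpace ℝ (Fin n)) M, ∀ x ∈ e.target, ∀ y ≠ 0,
    (fundamentalMatrix F e x y).PosDef

/-- The components of the fundamental tensor are `C^{1,1}_loc` on `TM \ 0`. -/
def HasC11FundamentalTensor (F : (x : M) → TangentSpace (𝓡 n) x → ℝ) : Prop :=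
  ∀ e ∈ atlas (EuclideanSpace ℝ (Fin n)) M, ∀ i j : Fin n,
    IsCk1LocOn 1
      (fun z : EuclideanSpace ℝ (Fin n) × EuclideanSpace ℝ (Fin n) =>
        fundamentalMatrix F e z.1 z.2 i j)
      (e.target ×ˢ {0}ᶜ)

/-- The reversed metric `F̃(x, y) = F(x, -y)`. -/
def reversed (F : (x : M) → TangentSpace (𝓡 n) x → ℝ) :
    (x : M) → TangentSpace (𝓡 n) x → ℝ :=
  fun x y => F x (-y)

/-! ### Geodesics and the exponential map -/

/-- The spray coefficients
`Gⁱ(x, y) = gⁱʲ(x, y) (½ ∂²F²/∂yʲ∂xᵏ(x, y) yᵏ - ½ ∂F²/∂xʲ(x, y)) = Γⁱⱼₖ(x, y) yʲ yᵏ`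
in the chart `e`.  For `y = 0` the bracket vanishes, so that `G(x, 0) = 0`, which is the continuous
extension of `G` to the zero section. -/
def spray (F : (x : M) → TangentSpace (𝓡 n) x → ℝ)
    (e : OpenPartialHomeomorph M (EuclideanSpace ℝ (Fin n)))
    (x y : EuclideanSpace ℝ (Fin n)) : EuclideanSpace ℝ (Fin n) :=
  WithLp.toLp 2 fun i => ∑ j, (fundamentalMatrix F e x y)⁻¹ i j *
    ((∑ k, (1 / 2 : ℝ) * dxdySq F e k j x y * y k) - (1 / 2 : ℝ) * dxSq F e j x y)

/-- `γ` is a (constant speed) geodesic of `F` on the open set of parameters `J`: it is a `C²` curve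
that satisfies the geodesic equation `γ'' + G(γ, γ') = 0` in every chart. -/
def IsGeodesicOn (F : (x : M) → TangentSpace (𝓡 n) x → ℝ) (γ : ℝ → M) (J : Set ℝ) : Prop :=
  ∀ s ∈ J, ContinuousAt γ s ∧
    ∀ e ∈ atlas (EuclideanSpace ℝ (Fin n)) M, γ s ∈ e.source →
      ContDiffAt ℝ 2 (e ∘ γ) s ∧
      deriv (deriv (e ∘ γ)) s + spray F e (e (γ s)) (deriv (e ∘ γ) s) = 0

/-- `γ` is a geodesic of `F` with `γ(0) = p` and `γ'(0) = v`, defined on an open interval that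
contains `[0, 1]`. -/
def IsUnitTimeGeodesic (F : (x : M) → TangentSpace (𝓡 n) x → ℝ) (p : M)
    (v : TangentSpace (𝓡 n) p) (γ : ℝ → M) : Prop :=
  (∃ a b : ℝ, a < 0 ∧ 1 < b ∧ IsGeodesicOn F γ (Ioo a b)) ∧ γ 0 = p ∧
    (mfderiv 𝓘(ℝ, ℝ) (𝓡 n) γ 0 (1 : ℝ) : EuclideanSpace ℝ (Fin n)) = v

/-- The set of vectors of `T_pM` at which the exponential map of `F` is defined. -/
def expDomain (F : (x : M) → TangentSpace (𝓡 n) x → ℝ) (p : M) : Set (TangentSpace (𝓡 n) p) :=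
  {v | ∃ γ : ℝ → M, IsUnitTimeGeodesic F p v γ}

open Classical in
/-- The exponential map of `F` at `p`: `exp_p(v) = γ(1)` for the geodesic `γ` with `γ(0) = p`,
`γ'(0) = v`; it is meaningful on `expDomain F p` and has the junk value `p` elsewhere. -/
def expMap (F : (x : M) → TangentSpace (𝓡 n) x → ℝ) (p : M) (v : TangentSpace (𝓡 n) p) : M :=
  if h : ∃ γ : ℝ → M, IsUnitTimeGeodesic F p v γ then h.choose 1 else p

/-! ### Hypersurfaces and their convexity -/

/-- `φ : M → ℝ` is of class `C^{k,1}_loc` on the open set `V`. -/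
def IsCk1LocOnManifold (n : ℕ) {M : Type*} [TopologicalSpace M]
    [ChartedSpace (EuclideanSpace ℝ (Fin n)) M] (k : ℕ) (φ : M → ℝ) (V : Set M) : Prop :=
  ∀ e ∈ atlas (EuclideanSpace ℝ (Fin n)) M,
    IsCk1LocOn k (φ ∘ e.symm) (e.target ∩ e.symm ⁻¹' V)

/-- In the open set `V`, the set `N` is the zero set of the `C^{2,1}_loc` function `φ`, which is
regular at the points of `N`. -/
structure IsDefiningFunction (n : ℕ) {M : Type*} [TopologicalSpace M]
    [ChartedSpace (EuclideanSpace ℝ (Fin n)) M] (N V : Set M) (φ : M → ℝ) : Prop where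
  isOpen : IsOpen V
  regularity : IsCk1LocOnManifold n 2 φ V
  zero_iff : ∀ x ∈ V, x ∈ N ↔ φ x = 0
  regular : ∀ x ∈ V ∩ N, mfderiv (𝓡 n) 𝓘(ℝ, ℝ) φ x ≠ 0

/-- `N` is a `C^{2,1}_loc` embedded hypersurface of `M`. -/
def IsC21Hypersurface (n : ℕ) {M : Type*} [TopologicalSpace M]
    [ChartedSpace (EuclideanSpace ℝ (Fin n)) M] (N : Set M) : Prop :=
  ∀ q ∈ N, ∃ (V : Set M) (φ : M → ℝ), q ∈ V ∧ IsDefiningFunction n N V φ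

/-- The tangent space `T_xN` of the hypersurface `N` at `x ∈ N`: the kernel of the differential of
a defining function near `x`. -/
def hypersurfaceTangent (N : Set M) (x : M) : Set (TangentSpace (𝓡 n) x) :=
  {v | ∃ (V : Set M) (φ : M → ℝ), x ∈ V ∧ IsDefiningFunction n N V φ ∧
    mfderiv (𝓡 n) 𝓘(ℝ, ℝ) φ x v = 0}

/-- In the open set `V`, `φ` is a defining function of `N` that is positive exactly on `D`. -/
structure IsInnerDefiningFunction (n : ℕ) {M : Type*} [TopologicalSpace M]
    [ChartedSpace (EuclideanSpace ℝ (Fin n)) M] (N D V : Set M) (φ : M → ℝ) : Prop where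
  defining : IsDefiningFunction n N V φ
  pos_iff : ∀ x ∈ V, x ∈ D ↔ 0 < φ x

/-- `D` is an inner domain of `N` in `U`: near each point of `U ∩ N` it is one of the two sides of
`N` (the one into which the chosen transverse direction points). -/
def IsInnerDomain (n : ℕ) {M : Type*} [TopologicalSpace M]
    [ChartedSpace (EuclideanSpace ℝ (Fin n)) M] (N U D : Set M) : Prop :=
  ∀ q ∈ U ∩ N, ∃ (V : Set M) (φ : M → ℝ), q ∈ V ∧ IsInnerDefiningFunction n N D V φ

/-- The Finslerian Hessian
`H_φ(x, y)[y, y] = ∂²φ/∂xⁱ∂xʲ(x) yⁱ yʲ - ∂φ/∂xᵏ(x) Γᵏᵢⱼ(x, y) yⁱ yʲ`, computed in the chart `e`.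
It is the second derivative at `0` of `φ ∘ γ`, for `γ` the geodesic of `F` with `γ(0) = x` and
`γ'(0) = y`, and so does not depend on `e`. -/
def hessian (F : (x : M) → TangentSpace (𝓡 n) x → ℝ)
    (e : OpenPartialHomeomorph M (EuclideanSpace ℝ (Fin n))) (φ : M → ℝ) (x : M)
    (y : TangentSpace (𝓡 n) x) : ℝ :=
  let Y : EuclideanSpace ℝ (Fin n) := mfderiv (𝓡 n) (𝓡 n) e x y
  fderiv ℝ (fderiv ℝ (φ ∘ e.symm)) (e x) Y Y - fderiv ℝ (φ ∘ e.symm) (e x) (spray F e (e x) Y)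

/-- `N` is infinitesimally convex at `x` with respect to the inner domain `D`: for some defining
function `φ` that is positive on `D`, `H_φ(x, y)[y, y] ≤ 0` for all non-zero `y ∈ T_xN`. -/
def IsInfinitesimallyConvexAt (F : (x : M) → TangentSpace (𝓡 n) x → ℝ) (N D : Set M)
    (x : M) : Prop :=
  ∃ (V : Set M) (φ : M → ℝ), x ∈ V ∧ IsInnerDefiningFunction n N D V φ ∧
    ∀ y ∈ hypersurfaceTangent (n := n) N x, y ≠ 0 →
      ∀ e ∈ atlas (EuclideanSpace ℝ (Fin n)) M, x ∈ e.source → hessian F e φ x y ≤ 0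

/-- `N` is locally convex at `p` with respect to the inner domain `D`: on some neighborhood `W` of
`0` in `T_pM` the exponential maps of `F` and of the reversed metric are defined, and neither of
them maps a vector of `W ∩ T_pN` into `D`. -/
def IsLocallyConvexAt (F : (x : M) → TangentSpace (𝓡 n) x → ℝ) (N D : Set M) (p : M) : Prop :=
  ∃ W ∈ 𝓝 (0 : TangentSpace (𝓡 n) p),
    W ⊆ expDomain F p ∧ W ⊆ expDomain (reversed F) p ∧
    ∀ v ∈ W ∩ hypersurfaceTangent (n := n) N p,
      expMap F p v ∉ D ∧ expMap (reversed F) p v ∉ D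

end

end Finsler

/-!
The proof compares the behaviour of a defining function along geodesics with a differential
inequality.

Let `φ` be a defining function of `N` near `q` that is positive on the inner domain, read as `f` in
a chart, and let `H(x, y) = D²f(x)[y, y] - Df(x)[G(x, y)]` be its Finslerian Hessian. Along a
geodesic `γ` the function `u = f ∘ γ` satisfies `u' = Df(γ)[γ']` and `u'' = H(γ, γ')`. Infinitesimal
convexity says that `H ≤ 0` on the vectors tangent to `N`. As `H` is Lipschitz near `(q, 0)`, and
as the distance from `(x, y)` to those vectors is controlled by `|f(x)| + |Df(x)[y]|`, it follows
that `H(x, y) ≤ C (|f(x)| + |Df(x)[y]|)` near `(q, 0)`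
(`Finsler.eventually_le_of_nonpos_on_tangent`). Hence `u'' ≤ C (|u| + |u'|)`, and if `γ` starts at
`q` tangentially to `N`, then `u(0) = u'(0) = 0`. Such a function is non-positive on an interval
whose length depends on `C` only (`Finsler.nonpos_of_deriv_deriv_le`), so `γ` does not enter
`D = {φ > 0}` on that interval. By homogeneity of the geodesic equation this becomes a statement
about time one for all short initial velocities.

Three further ingredients are needed.

* The spray coefficients are Lipschitz near every vector, including the zero vectors
  (`Finsler.IsRegularMetric.lipschitzNear_spray`). Euler's relations express `F²` and its fiber
  derivatives through the fundamental tensor, which gives the claim off the zero section, and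
  homogeneity of degree two extends it. This yields the local existence and the uniqueness of
  geodesics, and the regularity of `H`.
* The geodesic equation is independent of the chart
  (`Finsler.IsRegularMetric.spray_transition`), because the spray is determined by the
  Euler–Lagrange expression of `F²` and the non-degenerate fundamental tensor.
* Infinitesimal convexity is independent of the defining function
  (`Finsler.second_deriv_nonpos_of_pos_iff`). This allows a single `φ` to be used near `q`,
  although the hypothesis at each point may refer to a defining function of its own.

The reversed metric satisfies the same hypotheses, with spray `G(x, -y)`, so the assertion about its
exponential map is the same theorem applied to it.
-/

namespace Finsler

/-! ### Functions that are Lipschitz near a point -/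

section Lipschitz

variable {α β γ : Type*} [PseudoEMetricSpace α] [PseudoEMetricSpace β] [PseudoEMetricSpace γ]

/-- `f` is Lipschitz on some neighborhood of `x`. -/
def LipschitzNear (f : α → β) (x : α) : Prop :=
  ∃ K, ∃ t ∈ 𝓝 x, LipschitzOnWith K f t

lemma LocallyLipschitzOn.lipschitzNear {f : α → β} {s : Set α} (h : LocallyLipschitzOn s f)
    (hs : IsOpen s) {x : α} (hx : x ∈ s) : LipschitzNear f x := by
  obtain ⟨K, t, ht, hK⟩ := h hx
  exact ⟨K, t, by rwa [hs.nhdsWithin_eq hx] at ht, hK⟩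

namespace LipschitzNear

lemma continuousAt {f : α → β} {x : α} (h : LipschitzNear f x) : ContinuousAt f x := by
  obtain ⟨K, t, ht, hK⟩ := h
  exact hK.continuousOn.continuousAt ht

lemma congr {f g : α → β} {x : α} (h : LipschitzNear f x) (hfg : g =ᶠ[𝓝 x] f) :
    LipschitzNear g x := by
  obtain ⟨K, t, ht, hK⟩ := h
  refine ⟨K, t ∩ {z | g z = f z}, inter_mem ht hfg, fun a ha b hb => ?_⟩
  rw [ha.2, hb.2]
  exact hK ha.1 hb.1

lemma comp {g : β → γ} {f : α → β} {x : α} (hg : LipschitzNear g (f x)) (hf : LipschitzNear f x) :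
    LipschitzNear (fun z => g (f z)) x := by
  have hc := hf.continuousAt
  obtain ⟨K, t, ht, hK⟩ := hf
  obtain ⟨K', t', ht', hK'⟩ := hg
  exact ⟨K' * K, t ∩ f ⁻¹' t', inter_mem ht (hc ht'),
    hK'.comp (hK.mono inter_subset_left) (fun z hz => hz.2)⟩

lemma prodMk {f : α → β} {g : α → γ} {x : α} (hf : LipschitzNear f x) (hg : LipschitzNear g x) :
    LipschitzNear (fun z => (f z, g z)) x := by
  obtain ⟨K, t, ht, hK⟩ := hf
  obtain ⟨K', t', ht', hK'⟩ := hg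
  exact ⟨max K K', t ∩ t', inter_mem ht ht',
    (hK.mono inter_subset_left).prodMk (hK'.mono inter_subset_right)⟩

lemma const (b : β) (x : α) : LipschitzNear (fun _ : α => b) x :=
  ⟨0, univ, univ_mem, (LipschitzWith.const b).lipschitzOnWith⟩

end LipschitzNear

end Lipschitz

lemma _root_.ContDiffAt.lipschitzNear {E G : Type*} [NormedAddCommGroup E] [NormedSpace ℝ E]
    [NormedAddCommGroup G] [NormedSpace ℝ G] {f : E → G} {x : E} (h : ContDiffAt ℝ 1 f x) :
    LipschitzNear f x :=
  h.exists_lipschitzOnWith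

namespace LipschitzNear

variable {α : Type*} [PseudoEMetricSpace α]
  {E G : Type*} [NormedAddCommGroup E] [NormedSpace ℝ E] [NormedAddCommGroup G] [NormedSpace ℝ G]

lemma clm_apply {A : α → E →L[ℝ] G} {v : α → E} {x : α} (hA : LipschitzNear A x)
    (hv : LipschitzNear v x) : LipschitzNear (fun z => A z (v z)) x := by
  have h : ContDiff ℝ 1 (fun p : (E →L[ℝ] G) × E => p.1 p.2) := contDiff_fst.clm_apply contDiff_snd
  exact LipschitzNear.comp (f := fun z => (A z, v z)) h.contDiffAt.lipschitzNear (hA.prodMk hv)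

lemma mul {f g : α → ℝ} {x : α} (hf : LipschitzNear f x) (hg : LipschitzNear g x) :
    LipschitzNear (fun z => f z * g z) x := by
  have h : ContDiff ℝ 1 (fun p : ℝ × ℝ => p.1 * p.2) := contDiff_fst.mul contDiff_snd
  exact LipschitzNear.comp (f := fun z => (f z, g z)) h.contDiffAt.lipschitzNear (hf.prodMk hg)

lemma smul {f : α → ℝ} {g : α → E} {x : α} (hf : LipschitzNear f x) (hg : LipschitzNear g x) :
    LipschitzNear (fun z => f z • g z) x := by
  have h : ContDiff ℝ 1 (fun p : ℝ × E => p.1 • p.2) := contDiff_fst.smul contDiff_snd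
  exact LipschitzNear.comp (f := fun z => (f z, g z)) h.contDiffAt.lipschitzNear (hf.prodMk hg)

lemma add {f g : α → E} {x : α} (hf : LipschitzNear f x) (hg : LipschitzNear g x) :
    LipschitzNear (fun z => f z + g z) x := by
  have h : ContDiff ℝ 1 (fun p : E × E => p.1 + p.2) := contDiff_fst.add contDiff_snd
  exact LipschitzNear.comp (f := fun z => (f z, g z)) h.contDiffAt.lipschitzNear (hf.prodMk hg)

lemma sub {f g : α → E} {x : α} (hf : LipschitzNear f x) (hg : LipschitzNear g x) :
    LipschitzNear (fun z => f z - g z) x := by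
  have h : ContDiff ℝ 1 (fun p : E × E => p.1 - p.2) := contDiff_fst.sub contDiff_snd
  exact LipschitzNear.comp (f := fun z => (f z, g z)) h.contDiffAt.lipschitzNear (hf.prodMk hg)

lemma neg {f : α → E} {x : α} (hf : LipschitzNear f x) : LipschitzNear (fun z => -f z) x := by
  simpa using (LipschitzNear.const (0 : E) x).sub hf

lemma sum {ι : Type*} (s : Finset ι) {f : ι → α → E} {x : α}
    (hf : ∀ i ∈ s, LipschitzNear (f i) x) : LipschitzNear (fun z => ∑ i ∈ s, f i z) x := by
  classical
  induction s using Finset.induction_on with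
  | empty => simpa using LipschitzNear.const (0 : E) x
  | insert i s hi ih =>
    simp only [Finset.sum_insert hi]
    exact (hf i (by simp)).add (ih fun j hj => hf j (by simp [hj]))

/-- Lipschitz estimates pass from `iteratedFDeriv ℝ 1` to `fderiv`. -/
lemma fderiv_of_iteratedFDeriv {f : E → G} {x : E} (h : LipschitzNear (iteratedFDeriv ℝ 1 f) x) :
    LipschitzNear (fderiv ℝ f) x := by
  obtain ⟨K, t, ht, hK⟩ := h
  refine ⟨K, t, ht, LipschitzOnWith.of_dist_le_mul fun a ha b hb => ?_⟩
  refine le_trans ?_ (hK.dist_le_mul a ha b hb)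
  rw [dist_eq_norm, dist_eq_norm]
  refine ContinuousLinearMap.opNorm_le_bound _ (norm_nonneg _) fun v => ?_
  have := (iteratedFDeriv ℝ 1 f a - iteratedFDeriv ℝ 1 f b).le_opNorm ![v]
  simpa [iteratedFDeriv_one_apply] using this

/-- Lipschitz estimates pass from `iteratedFDeriv ℝ 2` to the second Fréchet derivative. -/
lemma fderiv_fderiv_of_iteratedFDeriv {f : E → G} {x : E}
    (h : LipschitzNear (iteratedFDeriv ℝ 2 f) x) : LipschitzNear (fderiv ℝ (fderiv ℝ f)) x := by
  obtain ⟨K, t, ht, hK⟩ := h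
  refine ⟨K, t, ht, LipschitzOnWith.of_dist_le_mul fun a ha b hb => ?_⟩
  refine le_trans ?_ (hK.dist_le_mul a ha b hb)
  rw [dist_eq_norm, dist_eq_norm]
  refine ContinuousLinearMap.opNorm_le_bound₂ _ (norm_nonneg _) fun v w => ?_
  have := (iteratedFDeriv ℝ 2 f a - iteratedFDeriv ℝ 2 f b).le_opNorm ![v, w]
  simpa [iteratedFDeriv_two_apply, Fin.prod_univ_two, mul_assoc] using this

end LipschitzNear

/-- A function `G(x, y)` that is positively homogeneous of degree two in `y` and locally Lipschitz
off `y = 0` is Lipschitz also near the points of the zero section.  Homogeneity reduces the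
estimate to the compact set `closedBall x₀ R ×ˢ sphere 0 1`. -/
lemma lipschitzNear_zero_section {E G : Type*} [NormedAddCommGroup E] [NormedSpace ℝ E]
    [FiniteDimensional ℝ E] [NormedAddCommGroup G] [NormedSpace ℝ G] {g : E → E → G} {Ω : Set E}
    (hΩ : IsOpen Ω)
    (hlip : ∀ x ∈ Ω, ∀ y ≠ 0, LipschitzNear (fun z : E × E => g z.1 z.2) (x, y))
    (hhom : ∀ x y (c : ℝ), 0 < c → g x (c • y) = c ^ 2 • g x y) (hzero : ∀ x, g x 0 = 0)
    {x₀ : E} (hx₀ : x₀ ∈ Ω) : LipschitzNear (fun z : E × E => g z.1 z.2) (x₀, 0) := by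
  have : ProperSpace E := FiniteDimensional.proper ℝ E
  obtain ⟨R, hR, hRΩ⟩ := Metric.nhds_basis_closedBall.mem_iff.1 (hΩ.mem_nhds hx₀)
  set S : Set (E × E) := Metric.closedBall x₀ R ×ˢ Metric.sphere (0 : E) 1 with hS
  have hSc : IsCompact S := (isCompact_closedBall _ _).prod (isCompact_sphere _ _)
  have hSl : LocallyLipschitzOn S (fun z : E × E => g z.1 z.2) := by
    rintro ⟨x, y⟩ ⟨hx, hy⟩
    have hy0 : y ≠ 0 := fun h => by simp [h] at hy
    obtain ⟨K, t, ht, hK⟩ := hlip x (hRΩ hx) y hy0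
    exact ⟨K, t, mem_nhdsWithin_of_mem_nhds ht, hK⟩
  obtain ⟨K, hK⟩ := hSl.exists_lipschitzOnWith_of_compact hSc
  obtain ⟨B, hB⟩ := hSc.exists_bound_of_continuousOn hK.continuousOn
  have hB' : ∀ z ∈ S, ‖g z.1 z.2‖ ≤ |B| := fun z hz => (hB z hz).trans (le_abs_self B)
  have hunit : ∀ y : E, y ≠ 0 → ‖y‖⁻¹ • y ∈ Metric.sphere (0 : E) 1 := fun y hy => by
    simp [norm_smul, hy]
  have hred : ∀ x (y : E), y ≠ 0 → g x y = ‖y‖ ^ 2 • g x (‖y‖⁻¹ • y) := fun x y hy => by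
    rw [← hhom x _ _ (norm_pos_iff.2 hy), smul_smul, mul_inv_cancel₀ (norm_ne_zero_iff.2 hy),
      one_smul]
  have hbound : ∀ x ∈ Metric.closedBall x₀ R, ∀ y : E, ‖y‖ ≤ 1 → ‖g x y‖ ≤ |B| * ‖y‖ := by
    intro x hx y hy
    rcases eq_or_ne y 0 with rfl | hy0
    · simp [hzero]
    rw [hred x y hy0, norm_smul, norm_pow, norm_norm]
    have h1 := hB' (x, ‖y‖⁻¹ • y) ⟨hx, hunit y hy0⟩
    have h2 : ‖y‖ ^ 2 ≤ ‖y‖ := by nlinarith [norm_nonneg y]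
    calc ‖y‖ ^ 2 * ‖g x (‖y‖⁻¹ • y)‖ ≤ ‖y‖ * |B| := by gcongr
      _ = |B| * ‖y‖ := mul_comm _ _
  refine ⟨3 * K + 2 * ⟨|B|, abs_nonneg B⟩, Metric.closedBall x₀ R ×ˢ Metric.closedBall 0 1,
    prod_mem_nhds (Metric.closedBall_mem_nhds _ hR) (Metric.closedBall_mem_nhds _ one_pos),
    LipschitzOnWith.of_dist_le_mul ?_⟩
  rintro ⟨x, y⟩ ⟨hx, hy⟩ ⟨x', y'⟩ ⟨hx', hy'⟩
  simp only [mem_closedBall_zero_iff] at hy hy'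
  simp only at hx hx'
  set d := dist (x, y) (x', y') with hd
  have hdx : dist x x' ≤ d := le_max_left _ _
  have hdy : ‖y - y'‖ ≤ d := by rw [← dist_eq_norm]; exact le_max_right _ _
  have hd0 : 0 ≤ d := dist_nonneg
  have hB0 := abs_nonneg B
  have hK0 : (0 : ℝ) ≤ K := K.2
  push_cast
  change dist (g x y) (g x' y') ≤ (3 * (K : ℝ) + 2 * |B|) * d
  rw [dist_eq_norm]
  rcases eq_or_ne y 0 with rfl | hy0
  · have h := hbound x' hx' y' hy'
    rw [hzero, zero_sub, norm_neg]
    rw [zero_sub, norm_neg] at hdy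
    nlinarith [mul_le_mul_of_nonneg_left hdy hB0, mul_nonneg hK0 hd0, mul_nonneg hB0 hd0]
  rcases eq_or_ne y' 0 with rfl | hy'0
  · have h := hbound x hx y hy
    rw [hzero, sub_zero]
    rw [sub_zero] at hdy
    nlinarith [mul_le_mul_of_nonneg_left hdy hB0, mul_nonneg hK0 hd0, mul_nonneg hB0 hd0]
  set e := ‖y‖⁻¹ • y
  set e' := ‖y'‖⁻¹ • y'
  have he' : ‖e'‖ = 1 := by simpa using hunit y' hy'0
  have hye : ‖y‖ • e = y := by
    rw [smul_smul, mul_inv_cancel₀ (norm_ne_zero_iff.2 hy0), one_smul]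
  have hye' : ‖y'‖ • e' = y' := by
    rw [smul_smul, mul_inv_cancel₀ (norm_ne_zero_iff.2 hy'0), one_smul]
  have hdiff : ‖y‖ * ‖e - e'‖ ≤ 2 * d := by
    have h1 : ‖y‖ • (e - e') = (y - y') + (‖y'‖ - ‖y‖) • e' := by
      rw [smul_sub, hye, sub_smul, hye']; abel
    calc ‖y‖ * ‖e - e'‖ = ‖‖y‖ • (e - e')‖ := by rw [norm_smul, norm_norm]
      _ ≤ ‖y - y'‖ + |‖y'‖ - ‖y‖| := by
        rw [h1]
        refine (norm_add_le _ _).trans ?_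
        rw [norm_smul, he', mul_one, Real.norm_eq_abs]
      _ ≤ ‖y - y'‖ + ‖y - y'‖ := by
        gcongr
        rw [norm_sub_rev y y']
        exact abs_norm_sub_norm_le _ _
      _ ≤ 2 * d := by linarith
  have hge : ‖g x e - g x' e'‖ ≤ K * (dist x x' + ‖e - e'‖) := by
    have h := hK.dist_le_mul (x, e) ⟨hx, hunit y hy0⟩ (x', e') ⟨hx', hunit y' hy'0⟩
    rw [dist_eq_norm] at h
    refine h.trans (mul_le_mul_of_nonneg_left ?_ hK0)
    rw [Prod.dist_eq, dist_eq_norm e e']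
    exact max_le_add_of_nonneg dist_nonneg (norm_nonneg _)
  have h1 : ‖y‖ ^ 2 * ‖g x e - g x' e'‖ ≤ 3 * K * d := by
    have hy2 : ‖y‖ ^ 2 ≤ 1 := pow_le_one₀ (norm_nonneg _) hy
    have ha : ‖y‖ ^ 2 * ‖e - e'‖ ≤ 2 * d := by
      calc ‖y‖ ^ 2 * ‖e - e'‖ = ‖y‖ * (‖y‖ * ‖e - e'‖) := by ring
        _ ≤ 1 * (‖y‖ * ‖e - e'‖) := by gcongr
        _ ≤ 2 * d := by linarith
    have hb : ‖y‖ ^ 2 * dist x x' ≤ d := by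
      calc ‖y‖ ^ 2 * dist x x' ≤ 1 * d := by gcongr
        _ = d := one_mul d
    calc ‖y‖ ^ 2 * ‖g x e - g x' e'‖ ≤ ‖y‖ ^ 2 * (K * (dist x x' + ‖e - e'‖)) := by gcongr
      _ = K * (‖y‖ ^ 2 * dist x x' + ‖y‖ ^ 2 * ‖e - e'‖) := by ring
      _ ≤ K * (d + 2 * d) := by gcongr
      _ = 3 * K * d := by ring
  have h2 : |‖y‖ ^ 2 - ‖y'‖ ^ 2| * ‖g x' e'‖ ≤ 2 * |B| * d := by
    have h3 := hB' (x', e') ⟨hx', hunit y' hy'0⟩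
    have h4 : |‖y‖ ^ 2 - ‖y'‖ ^ 2| ≤ 2 * d := by
      rw [sq_sub_sq, abs_mul, abs_of_nonneg (by positivity)]
      have := (abs_norm_sub_norm_le y y').trans hdy
      nlinarith [abs_nonneg (‖y‖ - ‖y'‖)]
    calc |‖y‖ ^ 2 - ‖y'‖ ^ 2| * ‖g x' e'‖ ≤ (2 * d) * |B| := by gcongr
      _ = 2 * |B| * d := by ring
  have h5 : g x y - g x' y' =
      ‖y‖ ^ 2 • (g x e - g x' e') + (‖y‖ ^ 2 - ‖y'‖ ^ 2) • g x' e' := by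
    rw [hred x y hy0, hred x' y' hy'0, smul_sub, sub_smul]; abel
  rw [h5]
  refine (norm_add_le _ _).trans ?_
  rw [norm_smul, norm_smul, norm_pow, norm_norm, Real.norm_eq_abs]
  linarith

/-! ### A second order differential inequality -/

/-- A solution of `u'' ≤ C (|u| + |u'|)` with `u(0) = u'(0) = 0` is non-positive for a time that
depends on `C` only.  If `u` were positive somewhere, `u'` would be positive at some `t₁`; with `V`
the maximum of `|u'|` on `[0, t₁]`, the inequality bounds each increment of `u'` on `[0, t₁]` by
something less than `V`, so that neither `V` nor `-V` can be a value of `u'`. -/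
lemma nonpos_of_deriv_deriv_le {u v a : ℝ → ℝ} {C δ : ℝ} (hC : 0 ≤ C) (hδ : C * δ * (1 + δ) < 1)
    (hu : ∀ t ∈ Icc 0 δ, HasDerivAt u (v t) t) (hv : ∀ t ∈ Icc 0 δ, HasDerivAt v (a t) t)
    (ha : ∀ t ∈ Icc 0 δ, a t ≤ C * (|u t| + |v t|)) (hu0 : u 0 = 0) (hv0 : v 0 = 0) :
    ∀ t ∈ Icc 0 δ, u t ≤ 0 := by
  intro t₀ ht₀
  by_contra! hpos
  have ht₀pos : 0 < t₀ := lt_of_le_of_ne ht₀.1 fun h => by simp [← h, hu0] at hpos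
  have hδ0 : 0 ≤ δ := ht₀.1.trans ht₀.2
  obtain ⟨t₁, ht₁, hvt₁⟩ := exists_hasDerivAt_eq_slope u v ht₀pos
    (fun t ht => (hu t ⟨ht.1, ht.2.trans ht₀.2⟩).continuousAt.continuousWithinAt)
    (fun t ht => hu t ⟨ht.1.le, ht.2.le.trans ht₀.2⟩)
  have hvpos : 0 < v t₁ := by
    rw [hvt₁, hu0]
    exact div_pos (by linarith) (by linarith)
  have hsub : Icc 0 t₁ ⊆ Icc 0 δ := Icc_subset_Icc_right (ht₁.2.le.trans ht₀.2)
  obtain ⟨s, hs, hmax⟩ := isCompact_Icc.exists_isMaxOn (nonempty_Icc.2 ht₁.1.le)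
    (f := fun t => |v t|)
    (fun t ht => (hv t (hsub ht)).continuousAt.abs.continuousWithinAt)
  set V := |v s| with hVdef
  have hmax' : ∀ t ∈ Icc 0 t₁, |v t| ≤ V := fun t ht => hmax ht
  have hV : 0 < V := by
    have := hmax' t₁ ⟨ht₁.1.le, le_rfl⟩
    rw [abs_of_pos hvpos] at this
    linarith
  have hub : ∀ t ∈ Icc 0 t₁, |u t| ≤ δ * V := by
    intro t ht
    rcases eq_or_lt_of_le ht.1 with rfl | h0
    · rw [hu0, abs_zero]; positivity
    obtain ⟨c, hc, hvc⟩ := exists_hasDerivAt_eq_slope u v h0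
      (fun r hr => (hu r (hsub ⟨hr.1, hr.2.trans ht.2⟩)).continuousAt.continuousWithinAt)
      (fun r hr => hu r (hsub ⟨hr.1.le, hr.2.le.trans ht.2⟩))
    have h1 : u t = t * v c := by
      rw [hvc, hu0]; field_simp; ring
    rw [h1, abs_mul, abs_of_pos h0]
    exact mul_le_mul (hsub ht).2 (hmax' c ⟨hc.1.le, hc.2.le.trans ht.2⟩) (abs_nonneg _) hδ0
  have hinc : ∀ r ∈ Icc 0 t₁, ∀ r' ∈ Icc 0 t₁, r ≤ r' → v r' - v r < V := by
    intro r hr r' hr' hrr'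
    rcases eq_or_lt_of_le hrr' with rfl | hlt
    · simpa using hV
    obtain ⟨c, hc, hac⟩ := exists_hasDerivAt_eq_slope v a hlt
      (fun q hq =>
        (hv q (hsub ⟨hr.1.trans hq.1, hq.2.trans hr'.2⟩)).continuousAt.continuousWithinAt)
      (fun q hq => hv q (hsub ⟨hr.1.trans hq.1.le, hq.2.le.trans hr'.2⟩))
    have hc' : c ∈ Icc 0 t₁ := ⟨hr.1.trans hc.1.le, hc.2.le.trans hr'.2⟩
    have h1 : v r' - v r = (r' - r) * a c := by
      have : r' - r ≠ 0 := by linarith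
      rw [hac]; field_simp
    have h2 : a c ≤ C * (1 + δ) * V := by
      have h3 : |u c| + |v c| ≤ (1 + δ) * V := by
        linarith [hub c hc', hmax' c hc']
      calc a c ≤ C * (|u c| + |v c|) := ha c (hsub hc')
        _ ≤ C * ((1 + δ) * V) := by gcongr
        _ = C * (1 + δ) * V := by ring
    have h4 : r' - r ≤ δ := by linarith [hr.1, (hsub hr').2]
    calc v r' - v r ≤ (r' - r) * (C * (1 + δ) * V) := by
          rw [h1]; exact mul_le_mul_of_nonneg_left h2 (by linarith)
      _ ≤ δ * (C * (1 + δ) * V) := by gcongr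
      _ = (C * δ * (1 + δ)) * V := by ring
      _ < 1 * V := by gcongr
      _ = V := one_mul V
  rcases le_total 0 (v s) with h | h
  · have h1 := hinc 0 ⟨le_rfl, ht₁.1.le⟩ s hs hs.1
    rw [hv0, sub_zero, hVdef, abs_of_nonneg h] at h1
    exact lt_irrefl _ h1
  · have h1 := hinc s hs t₁ ⟨ht₁.1.le, le_rfl⟩ hs.2
    rw [hVdef, abs_of_nonpos h] at h1
    linarith

/-! ### Flows of Lipschitz vector fields -/

/-- **Picard–Lindelöf** near a point at which the vector field is Lipschitz, with a uniform time of
existence and with control on the location of the integral curves. -/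
lemma LipschitzNear.exists_integralCurve {E : Type*} [NormedAddCommGroup E] [NormedSpace ℝ E]
    [CompleteSpace E] {X : E → E} {z₀ : E} (hX : LipschitzNear X z₀) {O : Set E} (hO : O ∈ 𝓝 z₀) :
    ∃ ε > 0, ∃ r > 0, ∀ z ∈ Metric.closedBall z₀ r, ∃ α : ℝ → E, α 0 = z ∧
      ∀ t ∈ Ioo (-ε) ε, HasDerivAt α (X (α t)) t ∧ α t ∈ O := by
  obtain ⟨K, t, ht, hK⟩ := hX
  obtain ⟨a, ha, hat⟩ := Metric.nhds_basis_closedBall.mem_iff.1 (inter_mem ht hO)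
  have hK' : LipschitzOnWith K X (Metric.closedBall z₀ a) :=
    hK.mono (hat.trans inter_subset_left)
  set B : ℝ := K * a + ‖X z₀‖ + 1 with hB
  have hB0 : 0 < B := by positivity
  have hbd : ∀ z ∈ Metric.closedBall z₀ a, ‖X z‖ ≤ B := by
    intro z hz
    have h := hK'.dist_le_mul z hz z₀ (Metric.mem_closedBall_self ha.le)
    have h2 : (K : ℝ) * dist z z₀ ≤ K * a := by gcongr; exact hz
    rw [dist_eq_norm] at h
    have h3 := norm_le_norm_sub_add (X z) (X z₀)
    linarith
  set ε := a / (2 * B) with hε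
  have hε0 : 0 < ε := by positivity
  have h0 : (0 : ℝ) ∈ Icc (-ε) ε := by simp [hε0.le]
  set t₀ : Icc (-ε) ε := ⟨0, h0⟩ with ht₀
  have hpl : IsPicardLindelof (fun _ => X) t₀ z₀ (NNReal.mk a ha.le)
      (NNReal.mk (a / 2) (half_pos ha).le) (NNReal.mk B hB0.le) K := by
    refine IsPicardLindelof.of_time_independent hbd hK' ?_
    change B * max (ε - 0) (0 - -ε) ≤ a - a / 2
    simp only [sub_zero, zero_sub, neg_neg, max_self]
    rw [hε]
    field_simp
    norm_num
  refine ⟨ε, hε0, a / 2, by positivity, fun z hz => ?_⟩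
  replace hz : z ∈ Metric.closedBall z₀ (NNReal.mk (a / 2) (half_pos ha).le : ℝ) := hz
  obtain ⟨α, hα⟩ := ODE.FunSpace.exists_isFixedPt_next hpl hz
  refine ⟨α.compProj, ?_, fun s hs => ⟨?_, ?_⟩⟩
  · change α.compProj (t₀ : ℝ) = z
    rw [ODE.FunSpace.compProj_val, ← hα, ODE.FunSpace.next_apply₀]
  · have h : HasDerivWithinAt α.compProj (X (α.compProj s)) (Icc (-ε) ε) s := by
      refine (ODE.hasDerivWithinAt_picard_Icc (f := fun _ => X) (t₀ := 0) (x₀ := z)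
        (u := Metric.closedBall z₀ a)
        h0 hpl.continuousOn_uncurry
        α.continuous_compProj.continuousOn (fun _ _ => α.compProj_mem_closedBall hpl.mul_max_le)
        (Ioo_subset_Icc_self hs)).congr_of_mem ?_ (Ioo_subset_Icc_self hs)
      intro t' ht'
      nth_rw 1 [← hα]
      rw [ODE.FunSpace.compProj_of_mem ht', ODE.FunSpace.next_apply]
    exact h.hasDerivAt (Icc_mem_nhds hs.1 hs.2)
  · exact (hat (α.compProj_mem_closedBall hpl.mul_max_le)).2

/-! ### Comparison of defining functions -/

section Defining

variable {E : Type*} [NormedAddCommGroup E] [NormedSpace ℝ E]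

lemma exists_apply_eq_one {L : E →L[ℝ] ℝ} (hL : L ≠ 0) : ∃ w, L w = 1 := by
  obtain ⟨v, hv⟩ := DFunLike.ne_iff.1 hL
  exact ⟨(L v)⁻¹ • v, by simpa using inv_mul_cancel₀ hv⟩

/-- Defining functions of the same hypersurface have the same tangent space: the second one is
constant, hence extremal, on the zero set of the first one, and the Lagrange multiplier rule
applies. -/
lemma fderiv_apply_eq_zero_of_zero_iff [CompleteSpace E] {f₁ f₂ : E → ℝ} {x : E}
    (h₁ : ContDiffAt ℝ 1 f₁ x) (h₂ : ContDiffAt ℝ 1 f₂ x) (hx : f₁ x = 0)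
    (hreg : fderiv ℝ f₁ x ≠ 0) (hiff : ∀ᶠ z in 𝓝 x, f₁ z = 0 ↔ f₂ z = 0) {v : E}
    (hv : fderiv ℝ f₁ x v = 0) : fderiv ℝ f₂ x v = 0 := by
  have hext : IsLocalExtrOn f₂ {z | f₁ z = f₁ x} x := by
    left
    filter_upwards [nhdsWithin_le_nhds hiff, self_mem_nhdsWithin] with z hz hz'
    rw [hz.1 (hz'.trans hx), hiff.self_of_nhds.1 hx]
  obtain ⟨a, b, hab, h⟩ := hext.exists_multipliers_of_hasStrictFDerivAt_1d
    (h₁.hasStrictFDerivAt one_ne_zero) (h₂.hasStrictFDerivAt one_ne_zero)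
  have hb : b ≠ 0 := by
    rintro rfl
    rw [zero_smul, add_zero, smul_eq_zero] at h
    exact hab (by simp [h.resolve_right hreg])
  have := congrArg (fun L : E →L[ℝ] ℝ => L v) h
  simpa [hv, hb] using this

/-- The first two derivatives of a `C²` function along the parabola `t ↦ x + t y + (t²/2) z`. -/
lemma hasDerivAt_comp_parabola {f : E → ℝ} {x : E} (hf : ContDiffAt ℝ 2 f x) (y z : E) :
    (∀ᶠ t : ℝ in 𝓝 0, HasDerivAt (fun t : ℝ => f (x + t • y + (t ^ 2 / 2) • z))
      (fderiv ℝ f (x + t • y + (t ^ 2 / 2) • z) (y + t • z)) t) ∧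
    HasDerivAt (fun t : ℝ => fderiv ℝ f (x + t • y + (t ^ 2 / 2) • z) (y + t • z))
      (fderiv ℝ (fderiv ℝ f) x y y + fderiv ℝ f x z) 0 := by
  have hc : ∀ t : ℝ, HasDerivAt (fun t : ℝ => x + t • y + (t ^ 2 / 2) • z) (y + t • z) t := by
    intro t
    have h1 : HasDerivAt (fun t : ℝ => t • y) ((1 : ℝ) • y) t := (hasDerivAt_id t).smul_const y
    have h2 : HasDerivAt (fun t : ℝ => (t ^ 2 / 2) • z) (t • z) t := by
      have := ((hasDerivAt_pow 2 t).div_const 2).smul_const z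
      convert this using 2
      simp
    simpa only [one_smul] using! (h1.const_add x).add h2
  have hc0 : x + (0 : ℝ) • y + ((0 : ℝ) ^ 2 / 2) • z = x := by simp
  constructor
  · have h1 : ∀ᶠ p in 𝓝 x, DifferentiableAt ℝ f p :=
      (hf.eventually (by simp)).mono fun p hp => hp.differentiableAt (by simp)
    have h2 : Tendsto (fun t : ℝ => x + t • y + (t ^ 2 / 2) • z) (𝓝 0) (𝓝 x) := by
      have := (hc 0).continuousAt.tendsto
      rwa [hc0] at this
    filter_upwards [h2.eventually h1] with t ht
    exact ht.hasFDerivAt.comp_hasDerivAt t (hc t)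
  · have h1 : HasFDerivAt (fderiv ℝ f) (fderiv ℝ (fderiv ℝ f) x)
        (x + (0 : ℝ) • y + ((0 : ℝ) ^ 2 / 2) • z) := by
      rw [hc0]
      exact ((hf.fderiv_right (m := 1) (by norm_num)).differentiableAt (by simp)).hasFDerivAt
    have h2 := h1.comp_hasDerivAt (0 : ℝ) (hc 0)
    have h3 : HasDerivAt (fun t : ℝ => y + t • z) z 0 := by
      simpa using ((hasDerivAt_id (0 : ℝ)).smul_const z).const_add y
    simpa using h2.clm_apply h3

lemma eventually_pos_of_second_deriv_pos {h h' : ℝ → ℝ} {a : ℝ} (h0 : h 0 = 0) (h'0 : h' 0 = 0)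
    (hh : ∀ᶠ t in 𝓝 0, HasDerivAt h (h' t) t) (hh' : HasDerivAt h' a 0) (ha : 0 < a) :
    ∀ᶠ t in 𝓝[≠] 0, 0 < h t := by
  have hk : ∀ᶠ t in 𝓝 (0 : ℝ), HasDerivAt (fun t => h t - a / 4 * t ^ 2) (h' t - a / 2 * t) t := by
    filter_upwards [hh] with t ht
    have := ht.sub ((hasDerivAt_pow 2 t).const_mul (a / 4))
    exact this.congr_deriv (by norm_num; ring)
  have hd : deriv (fun t => h t - a / 4 * t ^ 2) =ᶠ[𝓝 0] fun t => h' t - a / 2 * t :=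
    hk.mono fun t ht => ht.deriv
  have hmin : IsLocalMin (fun t => h t - a / 4 * t ^ 2) 0 := by
    apply isLocalMin_of_deriv_deriv_pos
    · have h1 : HasDerivAt (fun t => h' t - a / 2 * t) (a - a / 2 * 1) 0 :=
        hh'.sub ((hasDerivAt_id (0 : ℝ)).const_mul (a / 2))
      rw [hd.deriv_eq, h1.deriv]
      linarith
    · rw [hd.eq_of_nhds]; simp [h'0]
    · exact hk.self_of_nhds.continuousAt
  filter_upwards [nhdsWithin_le_nhds hmin, self_mem_nhdsWithin] with t ht ht0
  have : 0 < t ^ 2 := sq_pos_of_ne_zero ht0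
  simp only [h0] at ht
  nlinarith

/-- The sign condition on the Hessian depends only on the side `{f > 0}` and not on the defining
function: otherwise a suitable parabola tangent to `y` would lie in `{f₂ > 0}` but not in
`{f₁ > 0}`. -/
lemma second_deriv_nonpos_of_pos_iff {f₁ f₂ : E → ℝ} {x : E}
    (h₁ : ContDiffAt ℝ 2 f₁ x) (h₂ : ContDiffAt ℝ 2 f₂ x) (hx₁ : f₁ x = 0) (hx₂ : f₂ x = 0)
    (hreg : fderiv ℝ f₁ x ≠ 0) (hiff : ∀ᶠ z in 𝓝 x, 0 < f₁ z ↔ 0 < f₂ z) {y z : E}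
    (hy₁ : fderiv ℝ f₁ x y = 0) (hy₂ : fderiv ℝ f₂ x y = 0)
    (h : fderiv ℝ (fderiv ℝ f₁) x y y + fderiv ℝ f₁ x z ≤ 0) :
    fderiv ℝ (fderiv ℝ f₂) x y y + fderiv ℝ f₂ x z ≤ 0 := by
  by_contra! hpos
  obtain ⟨w, hw⟩ := exists_apply_eq_one hreg
  set A := fderiv ℝ (fderiv ℝ f₂) x y y + fderiv ℝ f₂ x z with hA
  -- `ε` is small enough for `A - ε * fderiv ℝ f₂ x w` to remain positive
  set ε := A / (2 * (|fderiv ℝ f₂ x w| + 1)) with hε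
  have hε0 : 0 < ε := by positivity
  have hεA : ε * fderiv ℝ f₂ x w < A := by
    have h1 : ε * fderiv ℝ f₂ x w ≤ ε * (|fderiv ℝ f₂ x w| + 1) := by
      gcongr; linarith [le_abs_self (fderiv ℝ f₂ x w)]
    have h2 : ε * (|fderiv ℝ f₂ x w| + 1) = A / 2 := by rw [hε]; field_simp
    linarith
  obtain ⟨hd₁, hdd₁⟩ := hasDerivAt_comp_parabola h₁ y (z - ε • w)
  obtain ⟨hd₂, hdd₂⟩ := hasDerivAt_comp_parabola h₂ y (z - ε • w)
  have e₁ := eventually_pos_of_second_deriv_pos (h := fun t : ℝ =>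
      -f₁ (x + t • y + (t ^ 2 / 2) • (z - ε • w))) (by simp [hx₁]) (by simp [hy₁])
      (hd₁.mono fun t ht => ht.neg) hdd₁.neg (by simp [hw]; linarith)
  have e₂ := eventually_pos_of_second_deriv_pos (h := fun t : ℝ =>
      f₂ (x + t • y + (t ^ 2 / 2) • (z - ε • w))) (by simp [hx₂]) (by simp [hy₂])
      hd₂ hdd₂ (by simp; linarith)
  have hc : Tendsto (fun t : ℝ => x + t • y + (t ^ 2 / 2) • (z - ε • w)) (𝓝[≠] 0) (𝓝 x) := by
    have : Continuous (fun t : ℝ => x + t • y + (t ^ 2 / 2) • (z - ε • w)) := by fun_prop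
    have h3 := this.tendsto 0
    simp only [zero_smul, add_zero, ne_eq, OfNat.ofNat_ne_zero, not_false_eq_true, zero_pow,
      zero_div] at h3
    exact h3.mono_left nhdsWithin_le_nhds
  obtain ⟨t, ht₁, ht₂, ht⟩ := (e₁.and (e₂.and (hc.eventually hiff))).exists
  have := ht.2 ht₂
  linarith

/-! ### From the boundary to a neighborhood -/

/-- If `H` is Lipschitz near `(x₀, 0)` and non-positive at the vectors tangent to `{f = 0}`, then
near `(x₀, 0)` it is bounded above by the distance to that set of vectors, which is controlled by
`|f x| + |df(x) y|`. -/
lemma eventually_le_of_nonpos_on_tangent {f : E → ℝ} {x₀ : E} (hf : ContDiffAt ℝ 2 f x₀)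
    (hf0 : f x₀ = 0) (hreg : fderiv ℝ f x₀ ≠ 0) {H : E × E → ℝ} (hH : LipschitzNear H (x₀, 0))
    (hneg : ∀ᶠ x in 𝓝 x₀, f x = 0 → ∀ y, fderiv ℝ f x y = 0 → H (x, y) ≤ 0) :
    ∃ C, 0 ≤ C ∧ ∀ᶠ z in 𝓝 (x₀, 0), H z ≤ C * (|f z.1| + |fderiv ℝ f z.1 z.2|) := by
  obtain ⟨w, hw⟩ := exists_apply_eq_one hreg
  obtain ⟨K, t, ht, hK⟩ := hH
  have hf' : ContDiffAt ℝ 1 (fderiv ℝ f) x₀ := hf.fderiv_right (by norm_num)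
  obtain ⟨L, s, hs, hL⟩ := hf'.lipschitzNear
  have hderiv : ∀ᶠ x in 𝓝 x₀, DifferentiableAt ℝ f x :=
    (hf.eventually (by simp)).mono fun p hp => hp.differentiableAt (by simp)
  have hw' : ∀ᶠ x in 𝓝 x₀, 1 / 2 < fderiv ℝ f x w := by
    have : ContinuousAt (fun x => fderiv ℝ f x w) x₀ :=
      hf'.continuousAt.clm_apply continuousAt_const
    exact this.eventually (lt_mem_nhds (by simp only [hw]; norm_num))
  obtain ⟨r₁, hr₁, hball₁⟩ := Metric.eventually_nhds_iff_ball.1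
    (hderiv.and (hw'.and ((eventually_mem_set.2 hs).and hneg)))
  obtain ⟨r₂, hr₂, hball₂⟩ := Metric.mem_nhds_iff.1 ht
  set r := min r₁ r₂ with hr
  have hr0 : 0 < r := lt_min hr₁ hr₂
  have hball : ∀ x ∈ Metric.ball x₀ r, DifferentiableAt ℝ f x ∧ 1 / 2 < fderiv ℝ f x w ∧ x ∈ s ∧
      (f x = 0 → ∀ y, fderiv ℝ f x y = 0 → H (x, y) ≤ 0) := fun x hx =>
    hball₁ x (Metric.ball_subset_ball (min_le_left _ _) hx)
  set W := ‖w‖ with hW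
  have hW0 : 0 ≤ W := norm_nonneg w
  have hL0 : (0 : ℝ) ≤ L := L.2
  set C₀ : ℝ := 2 * W + 2 * W * (1 + 2 * L * W) with hC₀
  have hC₀0 : 0 ≤ C₀ := by positivity
  set q : E × E → ℝ := fun z => |f z.1| + |fderiv ℝ f z.1 z.2| with hq
  have hqc : ContinuousAt q (x₀, 0) := by
    have h1 : ContinuousAt (fun z : E × E => f z.1) (x₀, 0) :=
      ContinuousAt.comp (f := Prod.fst) (x := (x₀, (0 : E))) hf.continuousAt continuousAt_fst
    have h2 : ContinuousAt (fun z : E × E => fderiv ℝ f z.1) (x₀, 0) :=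
      ContinuousAt.comp (f := Prod.fst) (x := (x₀, (0 : E))) hf'.continuousAt continuousAt_fst
    exact h1.abs.add (h2.clm_apply continuousAt_snd).abs
  have hqs : ∀ᶠ z in 𝓝 (x₀, (0 : E)), C₀ * q z < r / 2 := by
    have : ContinuousAt (fun z => C₀ * q z) (x₀, 0) := continuousAt_const.mul hqc
    refine this.eventually (gt_mem_nhds ?_)
    simp [hq, hf0, hr0]
  refine ⟨K * C₀, by positivity, ?_⟩
  filter_upwards [hqs, Metric.ball_mem_nhds (x₀, (0 : E)) (half_pos hr0),
    Metric.ball_mem_nhds (x₀, (0 : E)) one_pos] with z hz hzr hz1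
  obtain ⟨x, y⟩ := z
  have hqx : |f x| ≤ q (x, y) := by simp [hq]
  have hq0 : 0 ≤ q (x, y) := (abs_nonneg _).trans hqx
  have hxr : dist x x₀ < r / 2 := lt_of_le_of_lt (le_max_left _ _) hzr
  have hy1 : ‖y‖ ≤ 1 := by
    have : dist y 0 < 1 := lt_of_le_of_lt (le_max_right _ _) hz1
    rw [dist_zero_right] at this
    exact this.le
  set b := 2 * |f x| with hb
  have hb0 : 0 ≤ b := by positivity
  have hbW : b * W ≤ C₀ * q (x, y) := by
    have h1 : b * W ≤ 2 * W * q (x, y) := by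
      rw [hb]
      calc 2 * |f x| * W = 2 * W * |f x| := by ring
        _ ≤ 2 * W * q (x, y) := by gcongr
    have h2 : 2 * W * q (x, y) ≤ C₀ * q (x, y) := by
      gcongr
      rw [hC₀]
      have : 0 ≤ 2 * W * (1 + 2 * L * W) := by positivity
      linarith
    exact h1.trans h2
  have hdist : ∀ a ∈ Icc (-b) b, ‖(x + a • w) - x‖ ≤ b * W := by
    intro a ha
    rw [add_sub_cancel_left, norm_smul]
    gcongr
    exact abs_le.2 ha
  have hin : ∀ a ∈ Icc (-b) b, x + a • w ∈ Metric.ball x₀ r := by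
    intro a ha
    have h1 := hdist a ha
    rw [← dist_eq_norm] at h1
    have h2 := dist_triangle (x + a • w) x x₀
    rw [Metric.mem_ball]
    linarith
  have hh : ∀ a ∈ Icc (-b) b,
      HasDerivAt (fun a : ℝ => f (x + a • w)) (fderiv ℝ f (x + a • w) w) a := by
    intro a ha
    have h1 : HasDerivAt (fun a : ℝ => x + a • w) w a := by
      simpa using ((hasDerivAt_id a).smul_const w).const_add x
    exact (hball _ (hin a ha)).1.hasFDerivAt.comp_hasDerivAt a h1
  have hcont : ContinuousOn (fun a : ℝ => f (x + a • w)) (Icc (-b) b) :=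
    fun a ha => (hh a ha).continuousAt.continuousWithinAt
  -- the derivative in direction `w` exceeds `1/2`, so `f` vanishes within `2 |f x|` of `x`
  have hmono := (convex_Icc (-b) b).mul_sub_le_image_sub_of_le_deriv hcont
    (fun a ha => (hh a (interior_subset ha)).differentiableAt.differentiableWithinAt)
    (C := 1 / 2) (fun a ha => by
      rw [(hh a (interior_subset ha)).deriv]
      exact (hball _ (hin a (interior_subset ha))).2.1.le)
  have hup := hmono 0 ⟨by linarith, hb0⟩ b ⟨by linarith, le_rfl⟩ hb0
  have hlo := hmono (-b) ⟨le_rfl, by linarith⟩ 0 ⟨by linarith, hb0⟩ (by linarith)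
  simp only [zero_smul, add_zero, sub_zero, zero_sub, neg_neg] at hup hlo
  obtain ⟨a, ha, hfa⟩ : (0 : ℝ) ∈ (fun a : ℝ => f (x + a • w)) '' Icc (-b) b := by
    refine intermediate_value_Icc (by linarith) hcont ⟨?_, ?_⟩
    · change f (x + (-b) • w) ≤ 0
      linarith [le_abs_self (f x)]
    · change 0 ≤ f (x + b • w)
      linarith [neg_abs_le (f x)]
  change f (x + a • w) = 0 at hfa
  set x' := x + a • w with hx'
  obtain ⟨-, hw2, hx's, hneg'⟩ := hball x' (hin a ha)
  set l := fderiv ℝ f x' y / fderiv ℝ f x' w with hl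
  set y' := y - l • w with hy'
  have hy'0 : fderiv ℝ f x' y' = 0 := by
    rw [hy', map_sub, map_smul, hl, smul_eq_mul, div_mul_cancel₀ _ (by linarith), sub_self]
  have hxs : x ∈ s := by
    refine (hball x ?_).2.2.1
    rw [Metric.mem_ball]; linarith
  have hlbound : |l| ≤ 2 * (1 + 2 * L * W) * q (x, y) := by
    have h1 : |fderiv ℝ f x' y| ≤ |fderiv ℝ f x y| + L * (b * W) := by
      have h2 := hL.dist_le_mul x' hx's x hxs
      rw [dist_eq_norm, dist_eq_norm] at h2
      have h3 := (fderiv ℝ f x' - fderiv ℝ f x).le_opNorm y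
      have h4 : ‖fderiv ℝ f x' - fderiv ℝ f x‖ * ‖y‖ ≤ L * (b * W) * 1 := by
        have h5 : ‖fderiv ℝ f x' - fderiv ℝ f x‖ ≤ L * (b * W) :=
          h2.trans (mul_le_mul_of_nonneg_left (hdist a ha) hL0)
        exact mul_le_mul h5 hy1 (norm_nonneg _) (by positivity)
      rw [sub_apply, Real.norm_eq_abs] at h3
      have h6 := abs_sub_abs_le_abs_sub (fderiv ℝ f x' y) (fderiv ℝ f x y)
      linarith
    have h2 : |l| ≤ 2 * |fderiv ℝ f x' y| := by
      rw [hl, abs_div, abs_of_pos (by linarith : 0 < fderiv ℝ f x' w), div_le_iff₀ (by linarith)]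
      nlinarith [abs_nonneg (fderiv ℝ f x' y)]
    have h3 : |fderiv ℝ f x y| ≤ q (x, y) := by simp [hq]
    have h4 : L * (b * W) ≤ 2 * L * W * q (x, y) := by
      calc L * (b * W) = 2 * L * W * |f x| := by rw [hb]; ring
        _ ≤ 2 * L * W * q (x, y) := by gcongr
    linarith
  have hclose : dist (x, y) (x', y') ≤ C₀ * q (x, y) := by
    refine max_le ?_ ?_
    · rw [dist_comm, dist_eq_norm]
      exact (hdist a ha).trans hbW
    · change dist y y' ≤ _
      rw [dist_eq_norm, hy', sub_sub_cancel, norm_smul, Real.norm_eq_abs, ← hW]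
      calc |l| * W ≤ 2 * (1 + 2 * L * W) * q (x, y) * W := by gcongr
        _ = (2 * W * (1 + 2 * L * W)) * q (x, y) := by ring
        _ ≤ C₀ * q (x, y) := by
          gcongr
          rw [hC₀]
          linarith
  have hzt : (x, y) ∈ t := by
    refine hball₂ (Metric.ball_subset_ball (min_le_right r₁ r₂) ?_)
    rw [Metric.mem_ball] at hzr ⊢
    linarith
  have hzt' : (x', y') ∈ t := by
    refine hball₂ (Metric.ball_subset_ball (min_le_right r₁ r₂) ?_)
    rw [Metric.mem_ball] at hzr ⊢
    have := dist_triangle (x', y') (x, y) (x₀, 0)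
    rw [dist_comm (x', y') (x, y)] at this
    linarith
  have h1 := hK.dist_le_mul (x, y) hzt (x', y') hzt'
  rw [Real.dist_eq] at h1
  have h2 := le_abs_self (H (x, y) - H (x', y'))
  have h3 : (K : ℝ) * dist (x, y) (x', y') ≤ K * (C₀ * q (x, y)) := by gcongr
  have h4 := hneg' hfa y' hy'0
  change H (x, y) ≤ K * C₀ * q (x, y)
  linarith

end Defining

/-! ### Functions of class `C^{1,1}` near a point -/

section C11

variable {E : Type*} [NormedAddCommGroup E] [NormedSpace ℝ E]

/-- `f` is `C¹` near `x` and its derivative is Lipschitz near `x`. -/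
def IsC11At (f : E → ℝ) (x : E) : Prop :=
  ContDiffAt ℝ 1 f x ∧ LipschitzNear (fderiv ℝ f) x

namespace IsC11At

lemma congr {f g : E → ℝ} {x : E} (hf : IsC11At f x) (h : g =ᶠ[𝓝 x] f) : IsC11At g x :=
  ⟨hf.1.congr_of_eventuallyEq h, hf.2.congr h.fderiv⟩

lemma eventually_differentiableAt {f : E → ℝ} {x : E} (hf : IsC11At f x) :
    ∀ᶠ z in 𝓝 x, DifferentiableAt ℝ f z :=
  (hf.1.eventually (by simp)).mono fun _ hp => hp.differentiableAt (by simp)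

lemma clm (L : E →L[ℝ] ℝ) (x : E) : IsC11At (fun z => L z) x := by
  refine ⟨L.contDiff.contDiffAt, ?_⟩
  have : fderiv ℝ (fun z => L z) = fun _ => L := funext fun z => L.fderiv
  rw [this]
  exact LipschitzNear.const L x

lemma const (c : ℝ) (x : E) : IsC11At (fun _ => c) x := by
  refine ⟨contDiffAt_const, ?_⟩
  have : fderiv ℝ (fun _ : E => c) = fun _ => 0 := funext fun z => fderiv_const_apply c
  rw [this]
  exact LipschitzNear.const 0 x

lemma mul {f g : E → ℝ} {x : E} (hf : IsC11At f x) (hg : IsC11At g x) :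
    IsC11At (fun z => f z * g z) x := by
  refine ⟨hf.1.mul hg.1, ?_⟩
  refine ((hf.1.lipschitzNear.smul hg.2).add (hg.1.lipschitzNear.smul hf.2)).congr ?_
  filter_upwards [hf.eventually_differentiableAt, hg.eventually_differentiableAt] with z h₁ h₂
  exact fderiv_fun_mul h₁ h₂

lemma add {f g : E → ℝ} {x : E} (hf : IsC11At f x) (hg : IsC11At g x) :
    IsC11At (fun z => f z + g z) x := by
  refine ⟨hf.1.add hg.1, ?_⟩
  refine (hf.2.add hg.2).congr ?_
  filter_upwards [hf.eventually_differentiableAt, hg.eventually_differentiableAt] with z h₁ h₂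
  exact fderiv_fun_add h₁ h₂

lemma comp_clm {E' : Type*} [NormedAddCommGroup E'] [NormedSpace ℝ E'] {f : E → ℝ} (T : E' →L[ℝ] E)
    {x : E'} (hf : IsC11At f (T x)) : IsC11At (fun z => f (T z)) x := by
  refine ⟨hf.1.comp x T.contDiff.contDiffAt, ?_⟩
  have h1 : ContDiff ℝ 1 (fun L : E →L[ℝ] ℝ => L.comp T) := contDiff_id.clm_comp contDiff_const
  refine (h1.contDiffAt.lipschitzNear.comp (f := fun z => fderiv ℝ f (T z))
    (hf.2.comp (f := fun z => T z) T.contDiff.contDiffAt.lipschitzNear)).congr ?_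
  filter_upwards [T.continuous.continuousAt.eventually hf.eventually_differentiableAt] with z hz
  exact (hz.hasFDerivAt.comp z T.hasFDerivAt).fderiv

lemma sum {ι : Type*} (s : Finset ι) {f : ι → E → ℝ} {x : E} (hf : ∀ i ∈ s, IsC11At (f i) x) :
    IsC11At (fun z => ∑ i ∈ s, f i z) x := by
  classical
  induction s using Finset.induction_on with
  | empty => simpa using IsC11At.const 0 x
  | insert i s hi ih =>
    simp only [Finset.sum_insert hi]
    exact (hf i (by simp)).add (ih fun j hj => hf j (by simp [hj]))

end IsC11At

lemma contDiffAt_det {m : ℕ} {A : E → Matrix (Fin m) (Fin m) ℝ} {x : E}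
    (h : ∀ i j, ContDiffAt ℝ 1 (fun z => A z i j) x) : ContDiffAt ℝ 1 (fun z => (A z).det) x := by
  simp only [Matrix.det_apply]
  refine ContDiffAt.sum fun σ _ => ?_
  exact (contDiffAt_prod fun i _ => h (σ i) i).const_smul _

lemma contDiffAt_matrix_inv {m : ℕ} {A : E → Matrix (Fin m) (Fin m) ℝ} {x : E}
    (h : ∀ i j, ContDiffAt ℝ 1 (fun z => A z i j) x) (hdet : (A x).det ≠ 0) (i j : Fin m) :
    ContDiffAt ℝ 1 (fun z => (A z)⁻¹ i j) x := by
  simp only [Matrix.inv_def, Matrix.smul_apply, Ring.inverse_eq_inv', smul_eq_mul,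
    Matrix.adjugate_apply]
  refine ((contDiffAt_det h).inv hdet).mul (contDiffAt_det fun k l => ?_)
  simp only [Matrix.updateRow_apply]
  split_ifs
  · exact contDiffAt_const
  · exact h k l

end C11

/-! ### Partial derivatives -/

lemma hasFDerivAt_left {E E' : Type*} [NormedAddCommGroup E] [NormedSpace ℝ E]
    [NormedAddCommGroup E'] [NormedSpace ℝ E'] {G : Type*} [NormedAddCommGroup G]
    [NormedSpace ℝ G] {f : E → E' → G} {x : E} {y : E'}
    (hf : DifferentiableAt ℝ (fun z : E × E' => f z.1 z.2) (x, y)) :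
    HasFDerivAt (fun x' => f x' y) ((fderiv ℝ (fun z : E × E' => f z.1 z.2) (x, y)).comp
      (ContinuousLinearMap.inl ℝ E E')) x :=
  hf.hasFDerivAt.comp (f := fun x' => (x', y)) x (hasFDerivAt_prodMk_left x y)

lemma hasFDerivAt_right {E E' : Type*} [NormedAddCommGroup E] [NormedSpace ℝ E]
    [NormedAddCommGroup E'] [NormedSpace ℝ E'] {G : Type*} [NormedAddCommGroup G]
    [NormedSpace ℝ G] {f : E → E' → G} {x : E} {y : E'}
    (hf : DifferentiableAt ℝ (fun z : E × E' => f z.1 z.2) (x, y)) :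
    HasFDerivAt (fun y' => f x y') ((fderiv ℝ (fun z : E × E' => f z.1 z.2) (x, y)).comp
      (ContinuousLinearMap.inr ℝ E E')) y :=
  hf.hasFDerivAt.comp (f := fun y' => (x, y')) y (hasFDerivAt_prodMk_right x y)

lemma lipschitzNear_partial {E E' : Type*} [NormedAddCommGroup E] [NormedSpace ℝ E]
    [NormedAddCommGroup E'] [NormedSpace ℝ E'] {f : E → E' → ℝ} {z : E × E'}
    (hf : IsC11At (fun z : E × E' => f z.1 z.2) z) (w : E) :
    LipschitzNear (fun z => fderiv ℝ (fun x' => f x' z.2) z.1 w) z := by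
  refine (hf.2.clm_apply (LipschitzNear.const ((w, 0) : E × E') z)).congr ?_
  filter_upwards [hf.eventually_differentiableAt] with z' hz'
  rw [(hasFDerivAt_left hz').fderiv]
  simp

/-! ### The fundamental tensor and the spray in a chart -/

section Metric

variable {n : ℕ} {M : Type*} [TopologicalSpace M] [ChartedSpace (EuclideanSpace ℝ (Fin n)) M]

/-- The part of the hypotheses on a Finsler metric on which its geodesics and their convexity
properties depend; unlike continuity on `TM`, these conditions pass to the reversed metric by
computations in charts. -/
structure IsRegularMetric (F : (x : M) → TangentSpace (𝓡 n) x → ℝ) : Prop where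
  zero_section : ∀ x, F x 0 = 0
  pos_homogeneous : ∀ x y (c : ℝ), 0 < c → F x (c • y) = c * F x y
  fiberwise_contDiff : ∀ e ∈ atlas (EuclideanSpace ℝ (Fin n)) M, ∀ x ∈ e.target,
    ContDiffOn ℝ 2 (fun y => sqIn F e x y) {0}ᶜ
  posDef : ∀ e ∈ atlas (EuclideanSpace ℝ (Fin n)) M, ∀ x ∈ e.target, ∀ y ≠ 0,
    (fundamentalMatrix F e x y).PosDef
  c11 : ∀ e ∈ atlas (EuclideanSpace ℝ (Fin n)) M, ∀ x ∈ e.target, ∀ y ≠ 0, ∀ i j : Fin n,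
    IsC11At (fun z : EuclideanSpace ℝ (Fin n) × EuclideanSpace ℝ (Fin n) =>
      fundamentalMatrix F e z.1 z.2 i j) (x, y)

lemma sum_basisVec (y : EuclideanSpace ℝ (Fin n)) : ∑ i, y i • basisVec i = y := by
  ext j
  simp [basisVec, Pi.single_apply]

lemma map_eq_sum_basisVec {G : Type*} [NormedAddCommGroup G] [NormedSpace ℝ G]
    (L : EuclideanSpace ℝ (Fin n) →L[ℝ] G) (y : EuclideanSpace ℝ (Fin n)) :
    L y = ∑ i, y i • L (basisVec i) := by
  conv_lhs => rw [← sum_basisVec y]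
  simp

variable {F : (x : M) → TangentSpace (𝓡 n) x → ℝ}
  {e : OpenPartialHomeomorph M (EuclideanSpace ℝ (Fin n))}

lemma fderiv_comp_smul_left {E : Type*} [NormedAddCommGroup E] [NormedSpace ℝ E] (f : E → ℝ)
    (c : ℝ) (y v : E) :
    fderiv ℝ (fun y' => f (c • y')) y v = c * fderiv ℝ f (c • y) v := by
  rw [fderiv_comp_smul]
  simp

lemma fderiv_fun_const_smul_field {E : Type*} [NormedAddCommGroup E] [NormedSpace ℝ E] (f : E → ℝ)
    (c : ℝ) (y : E) : fderiv ℝ (fun y' => c • f y') y = c • fderiv ℝ f y :=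
  congrFun (fderiv_const_smul_field (f := f) c) y

namespace IsRegularMetric

/-! ### Homogeneity -/

lemma sqIn_smul (hF : IsRegularMetric F) (x y : EuclideanSpace ℝ (Fin n)) {c : ℝ} (hc : 0 < c) :
    sqIn F e x (c • y) = c ^ 2 * sqIn F e x y := by
  unfold sqIn
  rw [← mul_pow, ← hF.pos_homogeneous _ _ c hc]
  congr 2
  exact map_smul (mfderiv (𝓡 n) (𝓡 n) e.symm x) c y

lemma dySq_smul (hF : IsRegularMetric F) (j : Fin n) (x y : EuclideanSpace ℝ (Fin n)) {c : ℝ}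
    (hc : 0 < c) : dySq F e j x (c • y) = c * dySq F e j x y := by
  have h1 := fderiv_comp_smul_left (fun y' => sqIn F e x y') c y (basisVec j)
  have h2 : (fun y' => sqIn F e x (c • y')) = fun y' => c ^ 2 • sqIn F e x y' :=
    funext fun y' => hF.sqIn_smul x y' hc
  rw [h2, fderiv_fun_const_smul_field] at h1
  unfold dySq
  have h3 : c * (c * fderiv ℝ (fun y' => sqIn F e x y') y (basisVec j)) =
      c * fderiv ℝ (fun y' => sqIn F e x y') (c • y) (basisVec j) := by
    rw [← h1]; simp; ring
  exact (mul_left_cancel₀ hc.ne' h3).symm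

lemma fundamentalMatrix_smul (hF : IsRegularMetric F) (x y : EuclideanSpace ℝ (Fin n)) {c : ℝ}
    (hc : 0 < c) : fundamentalMatrix F e x (c • y) = fundamentalMatrix F e x y := by
  ext i j
  have h1 := fderiv_comp_smul_left (fun y' => dySq F e j x y') c y (basisVec i)
  have h2 : (fun y' => dySq F e j x (c • y')) = fun y' => c • dySq F e j x y' :=
    funext fun y' => hF.dySq_smul j x y' hc
  rw [h2, fderiv_fun_const_smul_field] at h1
  simp only [fundamentalMatrix, Matrix.of_apply]
  congr 1
  exact (mul_left_cancel₀ hc.ne' (by simpa using h1)).symm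

lemma spray_smul (hF : IsRegularMetric F) (x y : EuclideanSpace ℝ (Fin n)) {c : ℝ} (hc : 0 < c) :
    spray F e x (c • y) = c ^ 2 • spray F e x y := by
  have h1 : ∀ j, dxSq F e j x (c • y) = c ^ 2 * dxSq F e j x y := fun j => by
    have : (fun x' => sqIn F e x' (c • y)) = fun x' => c ^ 2 • sqIn F e x' y :=
      funext fun x' => hF.sqIn_smul x' y hc
    unfold dxSq
    rw [this, fderiv_fun_const_smul_field]
    simp
  have h2 : ∀ k j, dxdySq F e k j x (c • y) = c * dxdySq F e k j x y := fun k j => by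
    have : (fun x' => dySq F e j x' (c • y)) = fun x' => c • dySq F e j x' y :=
      funext fun x' => hF.dySq_smul j x' y hc
    unfold dxdySq
    rw [this, fderiv_fun_const_smul_field]
    simp
  ext i
  have h3 : ∀ j, ∑ k, (1 / 2 : ℝ) * (c * dxdySq F e k j x y) * (c * y k) =
      c ^ 2 * ∑ k, (1 / 2 : ℝ) * dxdySq F e k j x y * y k := fun j => by
    rw [Finset.mul_sum]
    exact Finset.sum_congr rfl fun k _ => by ring
  simp only [spray, hF.fundamentalMatrix_smul x y hc, h1, h2, PiLp.smul_apply, smul_eq_mul, h3]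
  rw [Finset.mul_sum]
  exact Finset.sum_congr rfl fun j _ => by ring

lemma spray_zero (hF : IsRegularMetric F) (x : EuclideanSpace ℝ (Fin n)) : spray F e x 0 = 0 := by
  have h1 : ∀ j, dxSq F e j x 0 = 0 := fun j => by
    have : (fun x' => sqIn F e x' 0) = fun _ => 0 := funext fun x' => by
      unfold sqIn
      have : mfderiv (𝓡 n) (𝓡 n) e.symm x' (0 : EuclideanSpace ℝ (Fin n)) = 0 :=
        map_zero (mfderiv (𝓡 n) (𝓡 n) e.symm x')
      rw [this, hF.zero_section]
      norm_num
    unfold dxSq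
    rw [this]
    simp
  ext i
  simp [spray, h1]

/-! ### Euler's relations and regularity -/

lemma contDiffAt_fiber (hF : IsRegularMetric F) (he : e ∈ atlas (EuclideanSpace ℝ (Fin n)) M)
    {x y : EuclideanSpace ℝ (Fin n)} (hx : x ∈ e.target) (hy : y ≠ 0) :
    ContDiffAt ℝ 2 (fun y' => sqIn F e x y') y :=
  (hF.fiberwise_contDiff e he x hx).contDiffAt (isOpen_compl_singleton.mem_nhds hy)

lemma differentiableAt_dySq_fiber (hF : IsRegularMetric F)
    (he : e ∈ atlas (EuclideanSpace ℝ (Fin n)) M) (j : Fin n)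
    {x y : EuclideanSpace ℝ (Fin n)} (hx : x ∈ e.target) (hy : y ≠ 0) :
    DifferentiableAt ℝ (fun y' => dySq F e j x y') y :=
  (((hF.contDiffAt_fiber he hx hy).fderiv_right (m := 1) (by norm_num)).differentiableAt
    (by simp)).clm_apply (differentiableAt_const _)

/-- **Euler's relation**: a differentiable positively homogeneous function of degree `m` satisfies
`Df(y) y = m f(y)`. -/
lemma _root_.fderiv_self_of_homogeneous {E : Type*} [NormedAddCommGroup E] [NormedSpace ℝ E]
    {f : E → ℝ} {y : E} (hf : DifferentiableAt ℝ f y) (m : ℕ)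
    (hhom : ∀ c : ℝ, 0 < c → f (c • y) = c ^ m * f y) : fderiv ℝ f y y = m * f y := by
  have h1 : HasDerivAt (fun c : ℝ => c • y) y 1 := by
    simpa using (hasDerivAt_id (1 : ℝ)).smul_const y
  have h2 : HasDerivAt (fun c : ℝ => f (c • y)) (fderiv ℝ f y y) 1 := by
    refine HasFDerivAt.comp_hasDerivAt (1 : ℝ) ?_ h1
    rw [one_smul]
    exact hf.hasFDerivAt
  have h3 : HasDerivAt (fun c : ℝ => c ^ m * f y) (m * f y) 1 := by
    simpa using (hasDerivAt_pow m (1 : ℝ)).mul_const (f y)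
  refine (h2.congr_of_eventuallyEq ?_).unique h3
  filter_upwards [lt_mem_nhds (zero_lt_one (α := ℝ))] with c hc
  exact (hhom c hc).symm

lemma dySq_eq (hF : IsRegularMetric F) (he : e ∈ atlas (EuclideanSpace ℝ (Fin n)) M) (j : Fin n)
    {x y : EuclideanSpace ℝ (Fin n)} (hx : x ∈ e.target) (hy : y ≠ 0) :
    dySq F e j x y = ∑ i, 2 * (y i * fundamentalMatrix F e x y i j) := by
  have h := fderiv_self_of_homogeneous (hF.differentiableAt_dySq_fiber he j hx hy) 1
    fun c hc => by rw [pow_one]; exact hF.dySq_smul j x y hc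
  rw [Nat.cast_one, one_mul, map_eq_sum_basisVec] at h
  rw [← h]
  refine Finset.sum_congr rfl fun i _ => ?_
  simp only [fundamentalMatrix, Matrix.of_apply, smul_eq_mul]
  ring

lemma fderiv_sqIn_apply (x y w : EuclideanSpace ℝ (Fin n)) :
    fderiv ℝ (fun y' => sqIn F e x y') y w = ∑ j, w j * dySq F e j x y := by
  rw [map_eq_sum_basisVec]
  rfl

lemma sqIn_eq (hF : IsRegularMetric F) (he : e ∈ atlas (EuclideanSpace ℝ (Fin n)) M)
    {x y : EuclideanSpace ℝ (Fin n)} (hx : x ∈ e.target) (hy : y ≠ 0) :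
    sqIn F e x y = ∑ j, (1 / 2) * (y j * dySq F e j x y) := by
  have h := fderiv_self_of_homogeneous
    ((hF.contDiffAt_fiber he hx hy).differentiableAt (by simp)) 2
    fun c hc => hF.sqIn_smul x y hc
  rw [fderiv_sqIn_apply] at h
  rw [← Finset.mul_sum, h]
  push_cast
  ring

lemma isC11At_coord {E : Type*} [NormedAddCommGroup E] [NormedSpace ℝ E] (i : Fin n)
    (z : E × EuclideanSpace ℝ (Fin n)) :
    IsC11At (fun z : E × EuclideanSpace ℝ (Fin n) => z.2 i) z :=
  IsC11At.clm ((EuclideanSpace.proj i).comp (ContinuousLinearMap.snd ℝ E _)) z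

lemma isC11At_dySq (hF : IsRegularMetric F)
    (he : e ∈ atlas (EuclideanSpace ℝ (Fin n)) M) (j : Fin n)
    {z : EuclideanSpace ℝ (Fin n) × EuclideanSpace ℝ (Fin n)} (hx : z.1 ∈ e.target)
    (hy : z.2 ≠ 0) : IsC11At (fun z => dySq F e j z.1 z.2) z := by
  refine (IsC11At.sum Finset.univ fun i _ => (IsC11At.const 2 z).mul
    ((isC11At_coord i z).mul (hF.c11 e he _ hx _ hy i j))).congr ?_
  filter_upwards [(e.open_target.prod isOpen_compl_singleton).mem_nhds
    (⟨hx, hy⟩ : z ∈ e.target ×ˢ {0}ᶜ)] with z' hz'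
  exact hF.dySq_eq he j hz'.1 hz'.2

lemma isC11At_sqIn (hF : IsRegularMetric F)
    (he : e ∈ atlas (EuclideanSpace ℝ (Fin n)) M)
    {z : EuclideanSpace ℝ (Fin n) × EuclideanSpace ℝ (Fin n)} (hx : z.1 ∈ e.target)
    (hy : z.2 ≠ 0) : IsC11At (fun z => sqIn F e z.1 z.2) z := by
  refine (IsC11At.sum Finset.univ fun j _ => (IsC11At.const (1 / 2) z).mul
    ((isC11At_coord j z).mul (hF.isC11At_dySq he j hx hy))).congr ?_
  filter_upwards [(e.open_target.prod isOpen_compl_singleton).mem_nhds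
    (⟨hx, hy⟩ : z ∈ e.target ×ˢ {0}ᶜ)] with z' hz'
  exact hF.sqIn_eq he hz'.1 hz'.2

/-- The spray coefficients are Lipschitz near every vector, the zero vectors included. -/
lemma lipschitzNear_spray (hF : IsRegularMetric F)
    (he : e ∈ atlas (EuclideanSpace ℝ (Fin n)) M)
    {x : EuclideanSpace ℝ (Fin n)} (hx : x ∈ e.target) (y : EuclideanSpace ℝ (Fin n)) :
    LipschitzNear (fun z : EuclideanSpace ℝ (Fin n) × EuclideanSpace ℝ (Fin n) =>
      spray F e z.1 z.2) (x, y) := by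
  have hne : ∀ x ∈ e.target, ∀ y ≠ 0,
      LipschitzNear (fun z : EuclideanSpace ℝ (Fin n) × EuclideanSpace ℝ (Fin n) =>
        spray F e z.1 z.2) (x, y) := by
    intro x hx y hy
    have h : ∀ i, LipschitzNear (fun z : EuclideanSpace ℝ (Fin n) × EuclideanSpace ℝ (Fin n) =>
        spray F e z.1 z.2 i) (x, y) := by
      intro i
      change LipschitzNear (fun z : EuclideanSpace ℝ (Fin n) × EuclideanSpace ℝ (Fin n) =>
        ∑ j, (fundamentalMatrix F e z.1 z.2)⁻¹ i j *
          ((∑ k, (1 / 2 : ℝ) * dxdySq F e k j z.1 z.2 * z.2 k) -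
            (1 / 2 : ℝ) * dxSq F e j z.1 z.2)) (x, y)
      refine LipschitzNear.sum _ fun j _ => LipschitzNear.mul ?_ ?_
      · refine (contDiffAt_matrix_inv
          (fun i j => (hF.c11 e he _ hx _ hy i j).1) ?_ i j).lipschitzNear
        exact (hF.posDef e he x hx y hy).det_pos.ne'
      · refine LipschitzNear.sub (LipschitzNear.sum _ fun k _ => ?_) ?_
        · exact ((LipschitzNear.const _ _).mul
            (lipschitzNear_partial (hF.isC11At_dySq he j hx hy) (basisVec k))).mul
            (isC11At_coord k _).1.lipschitzNear
        · exact (LipschitzNear.const _ _).mul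
            (lipschitzNear_partial (hF.isC11At_sqIn he hx hy) (basisVec j))
    have h' := LipschitzNear.sum Finset.univ fun i _ =>
      LipschitzNear.smul (h i) (LipschitzNear.const (basisVec i) (x, y))
    simpa only [sum_basisVec] using h'
  rcases eq_or_ne y 0 with rfl | hy
  · exact lipschitzNear_zero_section e.open_target hne (fun x y c hc => hF.spray_smul x y hc)
      hF.spray_zero hx
  · exact hne x hx y hy

/-- The defining property of the spray, free of coordinates: it is the Euler–Lagrange expression of
`F²` turned into a vector by means of the fundamental tensor. -/
lemma fundamental_spray (hF : IsRegularMetric F)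
    (he : e ∈ atlas (EuclideanSpace ℝ (Fin n)) M)
    {x y : EuclideanSpace ℝ (Fin n)} (hx : x ∈ e.target) (hy : y ≠ 0)
    (w : EuclideanSpace ℝ (Fin n)) :
    fderiv ℝ (fun y' => fderiv ℝ (fun y'' => sqIn F e x y'') y' w) y (spray F e x y) =
      fderiv ℝ (fun x' => fderiv ℝ (fun y' => sqIn F e x' y') y w) x y -
        fderiv ℝ (fun x' => sqIn F e x' y) x w := by
  have hdx : ∀ j, DifferentiableAt ℝ (fun x' => dySq F e j x' y) x := fun j =>
    (hasFDerivAt_left ((hF.isC11At_dySq he j (z := (x, y)) hx hy).1.differentiableAt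
      (by simp))).differentiableAt
  simp only [fderiv_sqIn_apply]
  rw [fderiv_fun_sum fun j _ => (hF.differentiableAt_dySq_fiber he j hx hy).const_mul _,
    fderiv_fun_sum fun j _ => (hdx j).const_mul _,
    map_eq_sum_basisVec (fderiv ℝ (fun x' => sqIn F e x' y) x) w]
  simp only [sum_apply, ← Finset.sum_sub_distrib]
  refine Finset.sum_congr rfl fun j _ => ?_
  rw [fderiv_const_mul (hF.differentiableAt_dySq_fiber he j hx hy), fderiv_const_mul (hdx j)]
  simp only [smul_apply, smul_eq_mul, ← mul_sub]
  congr 1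
  have hpd := hF.posDef e he x hx y hy
  have hsymm : ∀ i, fundamentalMatrix F e x y i j = fundamentalMatrix F e x y j i := fun i => by
    simpa using hpd.1.apply j i
  set b : Fin n → ℝ := fun j =>
    (∑ k, (1 / 2 : ℝ) * dxdySq F e k j x y * y k) - (1 / 2 : ℝ) * dxSq F e j x y with hb
  have hsp : ∀ i, spray F e x y i = ((fundamentalMatrix F e x y)⁻¹.mulVec b) i := fun i => rfl
  have hgb : ∑ i, fundamentalMatrix F e x y j i * spray F e x y i = b j := by
    have h1 : (fundamentalMatrix F e x y).mulVec ((fundamentalMatrix F e x y)⁻¹.mulVec b) = b := by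
      rw [Matrix.mulVec_mulVec, Matrix.mul_nonsing_inv _ (isUnit_iff_ne_zero.2 hpd.det_pos.ne'),
        Matrix.one_mulVec]
    have h2 := congrFun h1 j
    rw [← h2]
    rfl
  rw [map_eq_sum_basisVec _ (spray F e x y), map_eq_sum_basisVec _ y]
  have hL : ∑ i, spray F e x y i • fderiv ℝ (fun y' => dySq F e j x y') y (basisVec i) =
      2 * b j := by
    rw [← hgb, Finset.mul_sum]
    refine Finset.sum_congr rfl fun i _ => ?_
    rw [← hsymm i]
    simp only [fundamentalMatrix, Matrix.of_apply, smul_eq_mul]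
    ring
  rw [hL, hb]
  simp only [mul_sub, Finset.mul_sum]
  congr 1
  · refine Finset.sum_congr rfl fun k _ => ?_
    simp only [dxdySq, smul_eq_mul]
    ring
  · simp only [dxSq]
    ring

end IsRegularMetric

end Metric

/-! ### Change of coordinates -/

section Lagrangian

variable {E : Type*} [NormedAddCommGroup E] [NormedSpace ℝ E]

/-- The transformation rule for the vertical Hessian and for the Euler–Lagrange expression
`∂ₓ∂ᵧL [y, w] - ∂ₓL [w]` of a Lagrangian under the change of coordinates
`(x, y) ↦ (ψ x, Dψ(x) y)`: the first is a tensor, and the second acquires the vertical Hessian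
of `D²ψ(x)[y, y]`. -/
lemma lagrangian_change {L L' : E → E → ℝ} {ψ : E → E} {x y : E} (hψ : ContDiffAt ℝ 2 ψ x)
    (hL : ∀ᶠ x' in 𝓝 x, ∀ y', L x' y' = L' (ψ x') (fderiv ℝ ψ x' y'))
    (hfib : ∀ᶠ z : E × E in 𝓝 (ψ x, fderiv ℝ ψ x y), DifferentiableAt ℝ (L' z.1) z.2)
    (hjoint : DifferentiableAt ℝ (fun z : E × E => L' z.1 z.2) (ψ x, fderiv ℝ ψ x y))
    (hP : DifferentiableAt ℝ (fun z : E × E => fderiv ℝ (L' z.1) z.2) (ψ x, fderiv ℝ ψ x y))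
    (w : E) :
    (∀ v, fderiv ℝ (fun y' => fderiv ℝ (L x) y' w) y v =
      fderiv ℝ (fun y' => fderiv ℝ (L' (ψ x)) y' (fderiv ℝ ψ x w)) (fderiv ℝ ψ x y)
        (fderiv ℝ ψ x v)) ∧
    fderiv ℝ (fun x' => fderiv ℝ (L x') y w) x y - fderiv ℝ (fun x' => L x' y) x w =
      fderiv ℝ (fun x' => fderiv ℝ (L' x') (fderiv ℝ ψ x y) (fderiv ℝ ψ x w)) (ψ x)
          (fderiv ℝ ψ x y) -
        fderiv ℝ (fun x' => L' x' (fderiv ℝ ψ x y)) (ψ x) (fderiv ℝ ψ x w) +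
      fderiv ℝ (fun y' => fderiv ℝ (L' (ψ x)) y' (fderiv ℝ ψ x w)) (fderiv ℝ ψ x y)
        (fderiv ℝ (fderiv ℝ ψ) x y y) := by
  set A := fderiv ℝ ψ x with hA
  set Q := fderiv ℝ (fun z : E × E => fderiv ℝ (L' z.1) z.2) (ψ x, A y) with hQ
  have hψ1 : HasFDerivAt ψ A x := (hψ.differentiableAt (by simp)).hasFDerivAt
  have hψ' : ContDiffAt ℝ 1 (fderiv ℝ ψ) x := hψ.fderiv_right (by norm_num)
  have hψ2 : HasFDerivAt (fderiv ℝ ψ) (fderiv ℝ (fderiv ℝ ψ) x) x :=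
    (hψ'.differentiableAt (by simp)).hasFDerivAt
  have hsymm : fderiv ℝ (fderiv ℝ ψ) x w y = fderiv ℝ (fderiv ℝ ψ) x y w :=
    hψ.isSymmSndFDerivAt (by simp) w y
  -- the fiber derivative of `L` near `(x, y)`
  have hkey : ∀ᶠ z : E × E in 𝓝 (x, y), ∀ u, fderiv ℝ (L z.1) z.2 u =
      fderiv ℝ (L' (ψ z.1)) (fderiv ℝ ψ z.1 z.2) (fderiv ℝ ψ z.1 u) := by
    have h1 : ContinuousAt (fun z : E × E => (ψ z.1, fderiv ℝ ψ z.1 z.2)) (x, y) := by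
      have h2 : ContinuousAt (fun z : E × E => ψ z.1) (x, y) :=
        ContinuousAt.comp (f := Prod.fst) (x := (x, y)) hψ.continuousAt continuousAt_fst
      have h3 : ContinuousAt (fun z : E × E => fderiv ℝ ψ z.1) (x, y) :=
        ContinuousAt.comp (f := Prod.fst) (x := (x, y)) hψ'.continuousAt continuousAt_fst
      exact h2.prodMk (h3.clm_apply continuousAt_snd)
    filter_upwards [h1.eventually hfib, (continuousAt_fst (p := (x, y))).eventually hL]
      with z hz hLz u
    have h4 : L z.1 = fun y' => L' (ψ z.1) (fderiv ℝ ψ z.1 y') := funext hLz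
    have h5 : HasFDerivAt (fun y' => L' (ψ z.1) (fderiv ℝ ψ z.1 y'))
        ((fderiv ℝ (L' (ψ z.1)) (fderiv ℝ ψ z.1 z.2)).comp (fderiv ℝ ψ z.1)) z.2 :=
      hz.hasFDerivAt.comp z.2 (fderiv ℝ ψ z.1).hasFDerivAt
    rw [h4, h5.fderiv]
    rfl
  have hkeyx : ∀ᶠ x' in 𝓝 x, fderiv ℝ (L x') y w =
      fderiv ℝ (L' (ψ x')) (fderiv ℝ ψ x' y) (fderiv ℝ ψ x' w) := by
    have h1 : ContinuousAt (fun x' => (x', y)) x := continuousAt_id.prodMk continuousAt_const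
    exact (h1.eventually hkey).mono fun x' h => h w
  have hkeyy : ∀ᶠ y' in 𝓝 y, fderiv ℝ (L x) y' w = fderiv ℝ (L' (ψ x)) (A y') (A w) := by
    have h1 : ContinuousAt (fun y' => (x, y')) y := continuousAt_const.prodMk continuousAt_id
    exact (h1.eventually hkey).mono fun y' h => h w
  have hPy : HasFDerivAt (fun y' => fderiv ℝ (L' (ψ x)) y')
      (Q.comp (ContinuousLinearMap.inr ℝ E E)) (A y) :=
    hasFDerivAt_right (f := fun a b => fderiv ℝ (L' a) b) hP
  have hPx : HasFDerivAt (fun x' => fderiv ℝ (L' x') (A y))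
      (Q.comp (ContinuousLinearMap.inl ℝ E E)) (ψ x) :=
    hasFDerivAt_left (f := fun a b => fderiv ℝ (L' a) b) hP
  have hvert : ∀ b, fderiv ℝ (fun y' => fderiv ℝ (L' (ψ x)) y' (A w)) (A y) b = Q (0, b) (A w) := by
    intro b
    rw [(hPy.clm_apply (hasFDerivAt_const (A w) (A y))).fderiv]
    simp
  have hhor : ∀ a, fderiv ℝ (fun x' => fderiv ℝ (L' x') (A y) (A w)) (ψ x) a =
      Q (a, 0) (A w) := by
    intro a
    rw [(hPx.clm_apply (hasFDerivAt_const (A w) (ψ x))).fderiv]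
    simp
  have hdA : ∀ u, HasFDerivAt (fun x' => fderiv ℝ ψ x' u)
      ((fderiv ℝ (fderiv ℝ ψ) x).flip u) x := by
    intro u
    have := hψ2.clm_apply (hasFDerivAt_const u x)
    simpa using this
  have hΦ : HasFDerivAt (fun x' => (ψ x', fderiv ℝ ψ x' y))
      (A.prod ((fderiv ℝ (fderiv ℝ ψ) x).flip y)) x := hψ1.prodMk (hdA y)
  refine ⟨fun v => ?_, ?_⟩
  · have h1 : HasFDerivAt (fun y' => fderiv ℝ (L' (ψ x)) (A y')) _ y :=
      hPy.comp y A.hasFDerivAt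
    rw [Filter.EventuallyEq.fderiv_eq hkeyy, hvert,
      (h1.clm_apply (hasFDerivAt_const (A w) y)).fderiv]
    simp
  · have h1 : HasFDerivAt (fun x' => fderiv ℝ (L' (ψ x')) (fderiv ℝ ψ x' y)) 
        (Q.comp (A.prod ((fderiv ℝ (fderiv ℝ ψ) x).flip y))) x :=
      HasFDerivAt.comp (g := fun z : E × E => fderiv ℝ (L' z.1) z.2) x hP.hasFDerivAt hΦ
    have h2 : fderiv ℝ (fun x' => fderiv ℝ (L x') y w) x y =
        Q (A y, fderiv ℝ (fderiv ℝ ψ) x y y) (A w) +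
          fderiv ℝ (L' (ψ x)) (A y) (fderiv ℝ (fderiv ℝ ψ) x y w) := by
      rw [Filter.EventuallyEq.fderiv_eq hkeyx, (h1.clm_apply (hdA w)).fderiv]
      simp [← hA, add_comm]
    have h3 : HasFDerivAt (fun x' => L' (ψ x') (fderiv ℝ ψ x' y)) 
        ((fderiv ℝ (fun z : E × E => L' z.1 z.2) (ψ x, A y)).comp
          (A.prod ((fderiv ℝ (fderiv ℝ ψ) x).flip y))) x :=
      HasFDerivAt.comp (g := fun z : E × E => L' z.1 z.2) x hjoint.hasFDerivAt hΦ
    have h4 : fderiv ℝ (fun x' => L x' y) x w =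
        fderiv ℝ (fun z : E × E => L' z.1 z.2) (ψ x, A y) (A w, fderiv ℝ (fderiv ℝ ψ) x w y) := by
      have h5 : (fun x' => L x' y) =ᶠ[𝓝 x] fun x' => L' (ψ x') (fderiv ℝ ψ x' y) :=
        hL.mono fun x' h => h y
      rw [h5.fderiv_eq, h3.fderiv]
      simp
    have h6 : fderiv ℝ (fun x' => L' x' (A y)) (ψ x) (A w) =
        fderiv ℝ (fun z : E × E => L' z.1 z.2) (ψ x, A y) (A w, 0) := by
      rw [(hasFDerivAt_left hjoint).fderiv]
      simp
    have h7 : fderiv ℝ (L' (ψ x)) (A y) (fderiv ℝ (fderiv ℝ ψ) x y w) =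
        fderiv ℝ (fun z : E × E => L' z.1 z.2) (ψ x, A y) (0, fderiv ℝ (fderiv ℝ ψ) x y w) := by
      have := (hasFDerivAt_right hjoint).fderiv
      change fderiv ℝ (fun y' => L' (ψ x) y') (A y) _ = _
      rw [this]
      simp
    have h8 : ∀ a b : E, ((a, b) : E × E) = (a, 0) + (0, b) := fun a b => by simp
    rw [h2, h4, hvert, hhor, h6, h7, hsymm, h8 (A y), h8 (A w), map_add, map_add, add_apply]
    ring

end Lagrangian

section Charts

variable {n : ℕ} {M : Type*} [TopologicalSpace M] [ChartedSpace (EuclideanSpace ℝ (Fin n)) M]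
  {F : (x : M) → TangentSpace (𝓡 n) x → ℝ}
  {e e' : OpenPartialHomeomorph M (EuclideanSpace ℝ (Fin n))}

lemma IsRegularMetric.differentiableAt_fderiv_sqIn (hF : IsRegularMetric F)
    (he : e ∈ atlas (EuclideanSpace ℝ (Fin n)) M)
    {z : EuclideanSpace ℝ (Fin n) × EuclideanSpace ℝ (Fin n)} (hx : z.1 ∈ e.target)
    (hy : z.2 ≠ 0) : DifferentiableAt ℝ
      (fun z : EuclideanSpace ℝ (Fin n) × EuclideanSpace ℝ (Fin n) =>
        fderiv ℝ (sqIn F e z.1) z.2) z := by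
  have h : (fun z : EuclideanSpace ℝ (Fin n) × EuclideanSpace ℝ (Fin n) =>
      fderiv ℝ (sqIn F e z.1) z.2) = fun z => ∑ j, dySq F e j z.1 z.2 •
        (EuclideanSpace.proj j : EuclideanSpace ℝ (Fin n) →L[ℝ] ℝ) := by
    funext z
    ext w
    have := IsRegularMetric.fderiv_sqIn_apply (F := F) (e := e) z.1 z.2 w
    simpa [mul_comm] using this
  rw [h]
  refine DifferentiableAt.fun_sum fun j _ => ?_
  exact ((hF.isC11At_dySq he j hx hy).1.differentiableAt (by simp)).smul_const _

/-- The vertical Hessian of `F²` is non-degenerate. -/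
lemma IsRegularMetric.eq_zero_of_fundamental_eq_zero (hF : IsRegularMetric F)
    (he : e ∈ atlas (EuclideanSpace ℝ (Fin n)) M) {x y u : EuclideanSpace ℝ (Fin n)}
    (hx : x ∈ e.target) (hy : y ≠ 0)
    (h : fderiv ℝ (fun y' => fderiv ℝ (sqIn F e x) y' u) y u = 0) : u = 0 := by
  by_contra hu
  have hu' : (u.ofLp : Fin n → ℝ) ≠ 0 := fun h0 => hu (by ext i; simp [h0])
  have hpos := (hF.posDef e he x hx y hy).dotProduct_mulVec_pos hu'
  have h1 : fderiv ℝ (fun y' => fderiv ℝ (sqIn F e x) y' u) y u =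
      2 * (star u.ofLp ⬝ᵥ (fundamentalMatrix F e x y).mulVec u.ofLp) := by
    have h2 : (fun y' => fderiv ℝ (sqIn F e x) y' u) = fun y' => ∑ j, u j * dySq F e j x y' :=
      funext fun y' => IsRegularMetric.fderiv_sqIn_apply x y' u
    rw [h2, fderiv_fun_sum fun j _ => (hF.differentiableAt_dySq_fiber he j hx hy).const_mul _]
    simp only [sum_apply, dotProduct, Matrix.mulVec, Finset.mul_sum]
    rw [Finset.sum_comm]
    refine Finset.sum_congr rfl fun j _ => ?_
    rw [fderiv_const_mul (hF.differentiableAt_dySq_fiber he j hx hy), smul_apply,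
      map_eq_sum_basisVec, smul_eq_mul, Finset.mul_sum]
    refine Finset.sum_congr rfl fun i _ => ?_
    simp only [fundamentalMatrix, Matrix.of_apply, smul_eq_mul, Pi.star_apply, star_trivial]
    ring
  rw [h1] at h
  linarith

variable [IsManifold (𝓡 n) ∞ M]

lemma mdifferentiable_atlas (he : e ∈ atlas (EuclideanSpace ℝ (Fin n)) M) :
    e.MDifferentiable (𝓡 n) (𝓡 n) := by
  have : IsManifold (𝓡 n) 1 M := IsManifold.of_le (n := ∞) (by simp)
  exact mdifferentiable_of_mem_atlas he

lemma mfderiv_symm_mfderiv (he : e ∈ atlas (EuclideanSpace ℝ (Fin n)) M) {p : M}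
    (hp : p ∈ e.source) (v : TangentSpace (𝓡 n) p) :
    mfderiv (𝓡 n) (𝓡 n) e.symm (e p) (mfderiv (𝓡 n) (𝓡 n) e p v) = v :=
  congrArg (fun T : TangentSpace (𝓡 n) p →L[ℝ] TangentSpace (𝓡 n) p => T v)
    ((mdifferentiable_atlas he).symm_comp_deriv hp)

lemma mfderiv_mfderiv_symm (he : e ∈ atlas (EuclideanSpace ℝ (Fin n)) M)
    {x : EuclideanSpace ℝ (Fin n)} (hx : x ∈ e.target) (v : EuclideanSpace ℝ (Fin n)) :
    mfderiv (𝓡 n) (𝓡 n) e (e.symm x) (mfderiv (𝓡 n) (𝓡 n) e.symm x v) = v :=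
  congrArg (fun T : EuclideanSpace ℝ (Fin n) →L[ℝ] EuclideanSpace ℝ (Fin n) => T v)
    ((mdifferentiable_atlas he).comp_symm_deriv hx)

lemma contDiffAt_transition (he : e ∈ atlas (EuclideanSpace ℝ (Fin n)) M)
    (he' : e' ∈ atlas (EuclideanSpace ℝ (Fin n)) M) {x : EuclideanSpace ℝ (Fin n)}
    (hx : x ∈ e.target) (hx' : e.symm x ∈ e'.source) : ContDiffAt ℝ 2 (e' ∘ e.symm) x := by
  have h1 : ContMDiffAt (𝓡 n) (𝓡 n) ∞ (e' ∘ e.symm) x :=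
    (contMDiffAt_of_mem_maximalAtlas (IsManifold.subset_maximalAtlas he') hx').comp x
      (contMDiffAt_symm_of_mem_maximalAtlas (IsManifold.subset_maximalAtlas he) hx)
  exact_mod_cast contDiffAt_infty.1 (contMDiffAt_iff_contDiffAt.1 h1) 2

lemma fderiv_transition (he : e ∈ atlas (EuclideanSpace ℝ (Fin n)) M)
    (he' : e' ∈ atlas (EuclideanSpace ℝ (Fin n)) M) {x : EuclideanSpace ℝ (Fin n)}
    (hx : x ∈ e.target) (hx' : e.symm x ∈ e'.source) (v : EuclideanSpace ℝ (Fin n)) :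
    fderiv ℝ (e' ∘ e.symm) x v =
      mfderiv (𝓡 n) (𝓡 n) e' (e.symm x) (mfderiv (𝓡 n) (𝓡 n) e.symm x v) := by
  rw [← mfderiv_eq_fderiv, mfderiv_comp x ((mdifferentiable_atlas he').mdifferentiableAt hx')
    ((mdifferentiable_atlas he).mdifferentiableAt_symm hx)]
  rfl

lemma sqIn_mfderiv (he : e ∈ atlas (EuclideanSpace ℝ (Fin n)) M) {p : M} (hp : p ∈ e.source)
    (v : TangentSpace (𝓡 n) p) : sqIn F e (e p) (mfderiv (𝓡 n) (𝓡 n) e p v) = F p v ^ 2 := by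
  have h : ∀ q, q = p → ∀ u : EuclideanSpace ℝ (Fin n), F q u = F p u := by
    rintro _ rfl _; rfl
  unfold sqIn
  rw [mfderiv_symm_mfderiv he hp v]
  exact congrArg (· ^ 2) (h _ (e.left_inv hp) v)

/-- The spray coefficients transform like second derivatives of curves. -/
lemma IsRegularMetric.spray_transition (hF : IsRegularMetric F)
    (he : e ∈ atlas (EuclideanSpace ℝ (Fin n)) M)
    (he' : e' ∈ atlas (EuclideanSpace ℝ (Fin n)) M) {x : EuclideanSpace ℝ (Fin n)}
    (hx : x ∈ e.target) (hx' : e.symm x ∈ e'.source) (y : EuclideanSpace ℝ (Fin n)) :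
    fderiv ℝ (e' ∘ e.symm) x (spray F e x y) =
      spray F e' (e' (e.symm x)) (fderiv ℝ (e' ∘ e.symm) x y) +
        fderiv ℝ (fderiv ℝ (e' ∘ e.symm)) x y y := by
  rcases eq_or_ne y 0 with rfl | hy
  · simp [hF.spray_zero]
  set ψ : EuclideanSpace ℝ (Fin n) → EuclideanSpace ℝ (Fin n) := e' ∘ e.symm with hψ
  set A := fderiv ℝ ψ x with hA
  have hψx : ψ x ∈ e'.target := e'.map_source hx'
  have hinj : Function.Injective A := by
    intro u v huv
    rw [hA, hψ, fderiv_transition he he' hx hx', fderiv_transition he he' hx hx'] at huv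
    have h1 := congrArg (mfderiv (𝓡 n) (𝓡 n) e'.symm (e' (e.symm x))) huv
    erw [mfderiv_symm_mfderiv he' hx', mfderiv_symm_mfderiv he' hx'] at h1
    have h2 := congrArg (mfderiv (𝓡 n) (𝓡 n) e (e.symm x)) h1
    erw [mfderiv_mfderiv_symm he hx, mfderiv_mfderiv_symm he hx] at h2
    exact h2
  have hsurj : Function.Surjective A :=
    LinearMap.injective_iff_surjective (f := A.toLinearMap).1 hinj
  have hAy : A y ≠ 0 := fun h => hy (hinj (by rw [h, map_zero]))
  have hLL : ∀ᶠ x' in 𝓝 x, ∀ y', sqIn F e x' y' = sqIn F e' (ψ x') (fderiv ℝ ψ x' y') := by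
    have h1 : ∀ᶠ x' in 𝓝 x, e.symm x' ∈ e'.source :=
      (e.continuousAt_symm hx).eventually (e'.open_source.mem_nhds hx')
    filter_upwards [h1, e.open_target.mem_nhds hx] with x' hx1 hx2 y'
    rw [hψ, fderiv_transition he he' hx2 hx1]
    exact (sqIn_mfderiv he' hx1 _).symm
  have hfib : ∀ᶠ z in 𝓝 (ψ x, A y), DifferentiableAt ℝ (sqIn F e' z.1) z.2 := by
    have h1 : e'.target ×ˢ ({0}ᶜ : Set (EuclideanSpace ℝ (Fin n))) ∈ 𝓝 (ψ x, A y) :=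
      (e'.open_target.prod isOpen_compl_singleton).mem_nhds ⟨hψx, hAy⟩
    filter_upwards [h1] with z hz
    exact (hF.contDiffAt_fiber he' hz.1 hz.2).differentiableAt (by simp)
  have hch := lagrangian_change (contDiffAt_transition he he' hx hx') hLL hfib
    ((hF.isC11At_sqIn he' (z := (ψ x, A y)) hψx hAy).1.differentiableAt (by simp))
    (hF.differentiableAt_fderiv_sqIn he' (z := (ψ x, A y)) hψx hAy)
  rw [← sub_eq_zero]
  -- by the transformation rule the difference of the two sides is in the kernel of the
  -- vertical Hessian
  apply hF.eq_zero_of_fundamental_eq_zero he' hψx hAy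
  obtain ⟨w, hw⟩ := hsurj (A (spray F e x y) -
    (spray F e' (e' (e.symm x)) (A y) + fderiv ℝ (fderiv ℝ ψ) x y y))
  rw [map_sub, map_add, ← hw]
  obtain ⟨h1, h2⟩ := hch w
  have h3 := hF.fundamental_spray he hx hy w
  have h4 := hF.fundamental_spray he' hψx hAy (A w)
  have h5 := h1 (spray F e x y)
  change fderiv ℝ (fun y' => fderiv ℝ (sqIn F e x) y' w) y (spray F e x y) = _ at h3
  rw [h5] at h3
  change fderiv ℝ (fun y' => fderiv ℝ (sqIn F e' (ψ x)) y' (A w)) (A y)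
    (spray F e' (e' (e.symm x)) (A y)) = _ at h4
  rw [h3, h4]
  change fderiv ℝ (fun x' => fderiv ℝ (sqIn F e x') y w) x y - _ = _ at h2
  linarith [h2]

end Charts

section Geometry

variable {n : ℕ} {M : Type*} [TopologicalSpace M] [ChartedSpace (EuclideanSpace ℝ (Fin n)) M]
  {F : (x : M) → TangentSpace (𝓡 n) x → ℝ}
  {e : OpenPartialHomeomorph M (EuclideanSpace ℝ (Fin n))}

/-! ### The reversed metric -/

lemma IsFinslerMetric.isRegularMetric [IsManifold (𝓡 n) ∞ M] (hF : IsFinslerMetric F)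
    (hF' : HasC11FundamentalTensor F) : IsRegularMetric F where
  zero_section x := (hF.eq_zero_iff x 0).2 rfl
  pos_homogeneous := hF.pos_homogeneous
  fiberwise_contDiff := hF.fiberwise_contDiff
  posDef := hF.posDef
  c11 e he x hx y hy i j := by
    have ho : IsOpen (e.target ×ˢ ({0}ᶜ : Set (EuclideanSpace ℝ (Fin n)))) :=
      e.open_target.prod isOpen_compl_singleton
    obtain ⟨h1, h2⟩ := hF' e he i j
    have hz : (x, y) ∈ e.target ×ˢ ({0}ᶜ : Set (EuclideanSpace ℝ (Fin n))) := ⟨hx, hy⟩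
    exact ⟨h1.contDiffAt (ho.mem_nhds hz),
      (LocallyLipschitzOn.lipschitzNear h2 ho hz).fderiv_of_iteratedFDeriv⟩

lemma sqIn_reversed (x y : EuclideanSpace ℝ (Fin n)) :
    sqIn (reversed F) e x y = sqIn F e x (-y) := by
  have h : mfderiv (𝓡 n) (𝓡 n) e.symm x (-y) = -mfderiv (𝓡 n) (𝓡 n) e.symm x y :=
    map_neg (mfderiv (𝓡 n) (𝓡 n) e.symm x) y
  unfold sqIn reversed
  rw [h]

lemma fderiv_comp_neg_apply {E : Type*} [NormedAddCommGroup E] [NormedSpace ℝ E] (f : E → ℝ)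
    (y v : E) : fderiv ℝ (fun y' => f (-y')) y v = -fderiv ℝ f (-y) v := by
  have := fderiv_comp_smul_left f (-1) y v
  simpa using this

lemma dySq_reversed (j : Fin n) (x y : EuclideanSpace ℝ (Fin n)) :
    dySq (reversed F) e j x y = -dySq F e j x (-y) := by
  unfold dySq
  simp only [sqIn_reversed]
  exact fderiv_comp_neg_apply _ y _

lemma fundamentalMatrix_reversed (x y : EuclideanSpace ℝ (Fin n)) :
    fundamentalMatrix (reversed F) e x y = fundamentalMatrix F e x (-y) := by
  ext i j
  simp only [fundamentalMatrix, Matrix.of_apply, dySq_reversed]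
  rw [fderiv_fun_neg, neg_apply, fderiv_comp_neg_apply (fun y' => dySq F e j x y'), neg_neg]

lemma spray_reversed (x y : EuclideanSpace ℝ (Fin n)) :
    spray (reversed F) e x y = spray F e x (-y) := by
  have h1 : ∀ j, dxSq (reversed F) e j x y = dxSq F e j x (-y) := fun j => by
    unfold dxSq
    simp only [sqIn_reversed]
  have h2 : ∀ k j, dxdySq (reversed F) e k j x y = -dxdySq F e k j x (-y) := fun k j => by
    unfold dxdySq
    simp only [dySq_reversed]
    rw [fderiv_fun_neg, neg_apply]
  ext i
  simp [spray, h1, h2, fundamentalMatrix_reversed]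

lemma IsRegularMetric.reversed (hF : IsRegularMetric F) : IsRegularMetric (reversed F) where
  zero_section x := by
    unfold Finsler.reversed
    rw [neg_zero, hF.zero_section]
  pos_homogeneous x y c hc := by
    unfold Finsler.reversed
    rw [← smul_neg, hF.pos_homogeneous x _ c hc]
  fiberwise_contDiff e he x hx := by
    simp only [sqIn_reversed]
    exact (hF.fiberwise_contDiff e he x hx).comp contDiff_neg.contDiffOn
      fun y hy => by simpa using hy
  posDef e he x hx y hy := by
    rw [fundamentalMatrix_reversed]
    exact hF.posDef e he x hx _ (neg_ne_zero.2 hy)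
  c11 e he x hx y hy i j := by
    simp only [fundamentalMatrix_reversed]
    exact IsC11At.comp_clm (x := (x, y))
      (f := fun z : EuclideanSpace ℝ (Fin n) × EuclideanSpace ℝ (Fin n) =>
        fundamentalMatrix F e z.1 z.2 i j)
      ((ContinuousLinearMap.fst ℝ (EuclideanSpace ℝ (Fin n)) (EuclideanSpace ℝ (Fin n))).prod
        (-ContinuousLinearMap.snd ℝ (EuclideanSpace ℝ (Fin n)) (EuclideanSpace ℝ (Fin n))))
      (hF.c11 e he x hx _ (neg_ne_zero.2 hy) i j)

lemma neg_mem_hypersurfaceTangent {N : Set M} {x : M} {v : TangentSpace (𝓡 n) x}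
    (hv : v ∈ hypersurfaceTangent N x) : -v ∈ hypersurfaceTangent N x := by
  obtain ⟨V, φ, hxV, hφ, h⟩ := hv
  refine ⟨V, φ, hxV, hφ, ?_⟩
  rw [map_neg, h, neg_zero]

lemma hessian_reversed (φ : M → ℝ) (x : M) (y : TangentSpace (𝓡 n) x) :
    hessian (reversed F) e φ x y = hessian F e φ x (-y) := by
  have h : mfderiv (𝓡 n) (𝓡 n) e x (-y) = -mfderiv (𝓡 n) (𝓡 n) e x y :=
    map_neg (mfderiv (𝓡 n) (𝓡 n) e x) y
  have key : ∀ Y Y' : EuclideanSpace ℝ (Fin n), Y' = -Y →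
      fderiv ℝ (fderiv ℝ (φ ∘ e.symm)) (e x) Y Y -
        fderiv ℝ (φ ∘ e.symm) (e x) (spray (reversed F) e (e x) Y) =
      fderiv ℝ (fderiv ℝ (φ ∘ e.symm)) (e x) Y' Y' -
        fderiv ℝ (φ ∘ e.symm) (e x) (spray F e (e x) Y') := by
    rintro Y _ rfl
    simp [spray_reversed]
  exact key _ _ h

lemma IsInfinitesimallyConvexAt.reversed {N D : Set M} {x : M}
    (h : IsInfinitesimallyConvexAt F N D x) :
    IsInfinitesimallyConvexAt (reversed F) N D x := by
  obtain ⟨V, φ, hxV, hφ, hH⟩ := h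
  refine ⟨V, φ, hxV, hφ, fun y hy hy0 e he hxe => ?_⟩
  rw [hessian_reversed]
  exact hH (-y) (neg_mem_hypersurfaceTangent hy) (neg_ne_zero.2 hy0) e he hxe

/-! ### Geodesics in charts -/

lemma contDiffOn_two_of_hasDerivAt {E : Type*} [NormedAddCommGroup E] [NormedSpace ℝ E]
    {c y a : ℝ → E} {J : Set ℝ} (hJ : IsOpen J) (hc : ∀ s ∈ J, HasDerivAt c (y s) s)
    (hy : ∀ s ∈ J, HasDerivAt y (a s) s) (ha : ContinuousOn a J) : ContDiffOn ℝ 2 c J := by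
  have h1 : ContDiffOn ℝ 1 y J := by
    rw [show (1 : WithTop ℕ∞) = 0 + 1 by norm_num, contDiffOn_succ_iff_deriv_of_isOpen hJ]
    refine ⟨fun s hs => (hy s hs).differentiableAt.differentiableWithinAt, by simp, ?_⟩
    exact contDiffOn_zero.2 (ha.congr fun s hs => (hy s hs).deriv)
  rw [show (2 : WithTop ℕ∞) = 1 + 1 by norm_num, contDiffOn_succ_iff_deriv_of_isOpen hJ]
  exact ⟨fun s hs => (hc s hs).differentiableAt.differentiableWithinAt, by simp,
    h1.congr fun s hs => (hc s hs).deriv⟩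

lemma IsGeodesicOn.mono {γ : ℝ → M} {J J' : Set ℝ} (h : IsGeodesicOn F γ J) (hJ : J' ⊆ J) :
    IsGeodesicOn F γ J' := fun s hs => h s (hJ hs)

/-- In a chart, the position and the velocity of a geodesic solve the first order system of the
spray. -/
lemma IsGeodesicOn.hasDerivAt {γ : ℝ → M} {J : Set ℝ} (h : IsGeodesicOn F γ J)
    (he : e ∈ atlas (EuclideanSpace ℝ (Fin n)) M) {s : ℝ} (hs : s ∈ J) (hse : γ s ∈ e.source) :
    HasDerivAt (fun t => (e (γ t), deriv (e ∘ γ) t))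
      (deriv (e ∘ γ) s, -spray F e (e (γ s)) (deriv (e ∘ γ) s)) s := by
  obtain ⟨h1, h2⟩ := (h s hs).2 e he hse
  have h3 : HasDerivAt (e ∘ γ) (deriv (e ∘ γ) s) s := (h1.differentiableAt (by simp)).hasDerivAt
  have h4 : ContDiffAt ℝ 1 (deriv (e ∘ γ)) s := by
    have := (h1.fderiv_right (m := 1) (by norm_num)).clm_apply
      (contDiffAt_const (c := (1 : ℝ)))
    exact this
  have h5 := (h4.differentiableAt (by simp)).hasDerivAt
  rw [eq_neg_of_add_eq_zero_left h2] at h5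
  exact h3.prodMk h5

/-- Two geodesics with the same initial velocity agree as long as the first one stays in a given
chart.  The set of parameters at which positions and velocities agree is closed because `M` is
Hausdorff, and open by the uniqueness of solutions in the chart. -/
lemma IsRegularMetric.geodesic_unique [T2Space M] (hF : IsRegularMetric F)
    (he : e ∈ atlas (EuclideanSpace ℝ (Fin n)) M) {γ₁ γ₂ : ℝ → M} {J : Set ℝ} (hJ : IsOpen J)
    (h₁ : IsGeodesicOn F γ₁ J) (h₂ : IsGeodesicOn F γ₂ J) {b : ℝ}
    (hb : 0 ≤ b) (hbJ : Icc 0 b ⊆ J) (hsrc : ∀ t ∈ Icc 0 b, γ₁ t ∈ e.source)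
    (h0 : γ₁ 0 = γ₂ 0) (h0' : deriv (e ∘ γ₁) 0 = deriv (e ∘ γ₂) 0) : γ₁ b = γ₂ b := by
  set S : Set ℝ := {t | γ₁ t = γ₂ t ∧ deriv (e ∘ γ₁) t = deriv (e ∘ γ₂) t} with hS
  have hsub : Icc 0 b ⊆ S := by
    refine IsClosed.Icc_subset_of_forall_mem_nhdsWithin ?_ ⟨h0, h0'⟩ ?_
    · refine isClosed_of_closure_subset fun t ht => ?_
      have htI : t ∈ Icc 0 b :=
        isClosed_Icc.closure_subset_iff.2 inter_subset_right ht
      have hfr : ∃ᶠ s in 𝓝 t, s ∈ S :=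
        (mem_closure_iff_frequently.1 ht).mono fun s hs => hs.1
      have ht₁ := h₁ t (hbJ htI)
      have ht₂ := h₂ t (hbJ htI)
      have heq : γ₁ t = γ₂ t :=
        tendsto_nhds_unique_of_frequently_eq ht₁.1.tendsto ht₂.1.tendsto (hfr.mono fun s hs => hs.1)
      have hd₁ := (h₁.hasDerivAt he (hbJ htI) (hsrc t htI)).continuousAt.snd
      have hd₂ := (h₂.hasDerivAt he (hbJ htI) (heq ▸ hsrc t htI)).continuousAt.snd
      exact ⟨⟨heq, tendsto_nhds_unique_of_frequently_eq hd₁.tendsto hd₂.tendsto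
        (hfr.mono fun s hs => hs.2)⟩, htI⟩
    · rintro t ⟨htS, htI'⟩
      have htI : t ∈ Icc 0 b := Ico_subset_Icc_self htI'
      have hsrc₂ : γ₂ t ∈ e.source := htS.1 ▸ hsrc t htI
      set X : EuclideanSpace ℝ (Fin n) × EuclideanSpace ℝ (Fin n) →
          EuclideanSpace ℝ (Fin n) × EuclideanSpace ℝ (Fin n) :=
        fun z => (z.2, -spray F e z.1 z.2) with hX
      have hev : ∀ {γ : ℝ → M}, IsGeodesicOn F γ J → γ t ∈ e.source → ∀ᶠ s in 𝓝 t, γ s ∈ e.source ∧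
          HasDerivAt (fun t => (e (γ t), deriv (e ∘ γ) t)) (X (e (γ s), deriv (e ∘ γ) s)) s := by
        intro γ hγ hγt
        filter_upwards [hJ.mem_nhds (hbJ htI),
          (hγ t (hbJ htI)).1.eventually (e.open_source.mem_nhds hγt)] with s hs hs'
        exact ⟨hs', hγ.hasDerivAt he hs hs'⟩
      have hev₁ := hev h₁ (hsrc t htI)
      have hev₂ := hev h₂ hsrc₂
      have hXl : LipschitzNear X (e (γ₁ t), deriv (e ∘ γ₁) t) :=
        LipschitzNear.prodMk contDiff_snd.contDiffAt.lipschitzNear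
          (hF.lipschitzNear_spray he (e.map_source (hsrc t htI)) _).neg
      obtain ⟨K, O, hO, hK⟩ := hXl
      have hz₁ : ContinuousAt (fun t => (e (γ₁ t), deriv (e ∘ γ₁) t)) t :=
        hev₁.self_of_nhds.2.continuousAt
      have hz₂ : ContinuousAt (fun t => (e (γ₂ t), deriv (e ∘ γ₂) t)) t :=
        hev₂.self_of_nhds.2.continuousAt
      have hzt : (e (γ₁ t), deriv (e ∘ γ₁) t) = (e (γ₂ t), deriv (e ∘ γ₂) t) := by
        rw [htS.1, htS.2]
      have huniq := ODE_solution_unique_of_eventually (v := fun _ => X) (s := fun _ => O) (K := K)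
        (Eventually.of_forall fun _ => hK)
        ((hev₁.mono fun s hs => hs.2).and (hz₁.eventually hO))
        ((hev₂.mono fun s hs => hs.2).and (hz₂.eventually
          (show O ∈ 𝓝 (e (γ₂ t), deriv (e ∘ γ₂) t) from hzt ▸ hO)))
        hzt
      refine mem_nhdsWithin_of_mem_nhds ?_
      filter_upwards [huniq, hev₁, hev₂] with s hs hs₁ hs₂
      have hs' := Prod.ext_iff.1 hs
      exact ⟨e.injOn hs₁.1 hs₂.1 hs'.1, hs'.2⟩
  exact (hsub ⟨hb, le_rfl⟩).1

variable [IsManifold (𝓡 n) ∞ M]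

/-- A curve that solves the geodesic equation in one chart is a geodesic. -/
lemma IsRegularMetric.isGeodesicOn_of_hasDerivAt (hF : IsRegularMetric F)
    (he : e ∈ atlas (EuclideanSpace ℝ (Fin n)) M) {c y : ℝ → EuclideanSpace ℝ (Fin n)}
    {J : Set ℝ} (hJ : IsOpen J) (hmem : ∀ s ∈ J, c s ∈ e.target)
    (hc : ∀ s ∈ J, HasDerivAt c (y s) s)
    (hy : ∀ s ∈ J, HasDerivAt y (-spray F e (c s) (y s)) s) :
    IsGeodesicOn F (e.symm ∘ c) J := by
  have ha : ContinuousOn (fun s => -spray F e (c s) (y s)) J := fun s hs =>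
    (ContinuousAt.comp (f := fun s => (c s, y s)) (x := s)
      (hF.lipschitzNear_spray he (hmem s hs) (y s)).continuousAt
      ((hc s hs).continuousAt.prodMk (hy s hs).continuousAt)).neg.continuousWithinAt
  have hc2 : ContDiffOn ℝ 2 c J := contDiffOn_two_of_hasDerivAt hJ hc hy ha
  intro s hs
  have hcs : ContinuousAt (e.symm ∘ c) s :=
    ContinuousAt.comp (e.continuousAt_symm (hmem s hs)) (hc s hs).continuousAt
  refine ⟨hcs, fun e' he' hs' => ?_⟩
  have hψ := contDiffAt_transition he he' (hmem s hs) hs'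
  have hderiv : ∀ t ∈ J, e.symm (c t) ∈ e'.source →
      HasDerivAt (e' ∘ e.symm ∘ c) (fderiv ℝ (e' ∘ e.symm) (c t) (y t)) t := fun t ht ht' =>
    ((contDiffAt_transition he he' (hmem t ht) ht').differentiableAt
      (by simp)).hasFDerivAt.comp_hasDerivAt t (hc t ht)
  have hev : deriv (e' ∘ e.symm ∘ c) =ᶠ[𝓝 s]
      fun t => fderiv ℝ (e' ∘ e.symm) (c t) (y t) := by
    filter_upwards [hJ.mem_nhds hs, hcs.eventually (e'.open_source.mem_nhds hs')] with t ht ht'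
    exact (hderiv t ht ht').deriv
  have h2 : HasDerivAt (fun t => fderiv ℝ (e' ∘ e.symm) (c t))
      (fderiv ℝ (fderiv ℝ (e' ∘ e.symm)) (c s) (y s)) s :=
    ((hψ.fderiv_right (m := 1) (by norm_num)).differentiableAt
      (by simp)).hasFDerivAt.comp_hasDerivAt s (hc s hs)
  refine ⟨hψ.comp s (hc2.contDiffAt (hJ.mem_nhds hs)), ?_⟩
  rw [hev.deriv_eq, (h2.clm_apply (hy s hs)).deriv, (hderiv s hs hs').deriv, map_neg,
    hF.spray_transition he he' (hmem s hs) hs' (y s)]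
  simp only [Function.comp_apply]
  abel

lemma IsGeodesicOn.deriv_eq {γ : ℝ → M} {J : Set ℝ} (h : IsGeodesicOn F γ J)
    (he : e ∈ atlas (EuclideanSpace ℝ (Fin n)) M) {s : ℝ} (hs : s ∈ J) (hse : γ s ∈ e.source) :
    deriv (e ∘ γ) s =
      mfderiv (𝓡 n) (𝓡 n) e (γ s) (mfderiv 𝓘(ℝ, ℝ) (𝓡 n) γ s (1 : ℝ)) := by
  have hcont := (h s hs).1
  have hd : MDifferentiableAt 𝓘(ℝ, ℝ) (𝓡 n) (e ∘ γ) s :=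
    (((h s hs).2 e he hse).1.differentiableAt (by simp)).mdifferentiableAt
  have hγ : MDifferentiableAt 𝓘(ℝ, ℝ) (𝓡 n) γ s := by
    have h1 : MDifferentiableAt 𝓘(ℝ, ℝ) (𝓡 n) (e.symm ∘ (e ∘ γ)) s :=
      ((mdifferentiable_atlas he).mdifferentiableAt_symm (e.map_source hse)).comp s hd
    refine h1.congr_of_eventuallyEq ?_
    filter_upwards [hcont.eventually (e.open_source.mem_nhds hse)] with t ht
    exact (e.left_inv ht).symm
  have h2 := mfderiv_comp s ((mdifferentiable_atlas he).mdifferentiableAt hse) hγ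
  rw [mfderiv_eq_fderiv] at h2
  have h3 := congrArg (fun L : ℝ →L[ℝ] EuclideanSpace ℝ (Fin n) => L 1) h2
  exact h3

end Geometry

section Hypersurface

variable {n : ℕ} {M : Type*} [TopologicalSpace M] [ChartedSpace (EuclideanSpace ℝ (Fin n)) M]
  {F : (x : M) → TangentSpace (𝓡 n) x → ℝ}
  {e : OpenPartialHomeomorph M (EuclideanSpace ℝ (Fin n))} {N D V : Set M} {φ : M → ℝ}

/-! ### Hypersurfaces in charts -/

lemma IsDefiningFunction.isOpen_chart (hφ : IsDefiningFunction n N V φ)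
    (e : OpenPartialHomeomorph M (EuclideanSpace ℝ (Fin n))) :
    IsOpen (e.target ∩ e.symm ⁻¹' V) :=
  e.isOpen_inter_preimage_symm hφ.isOpen

lemma IsDefiningFunction.contDiffAt (hφ : IsDefiningFunction n N V φ)
    (he : e ∈ atlas (EuclideanSpace ℝ (Fin n)) M) {x : EuclideanSpace ℝ (Fin n)}
    (hx : x ∈ e.target) (hxV : e.symm x ∈ V) : ContDiffAt ℝ 2 (φ ∘ e.symm) x := by
  have := (hφ.regularity e he).1
  exact this.contDiffAt ((hφ.isOpen_chart e).mem_nhds ⟨hx, hxV⟩)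

lemma IsDefiningFunction.lipschitzNear_fderiv_fderiv (hφ : IsDefiningFunction n N V φ)
    (he : e ∈ atlas (EuclideanSpace ℝ (Fin n)) M) {x : EuclideanSpace ℝ (Fin n)}
    (hx : x ∈ e.target) (hxV : e.symm x ∈ V) :
    LipschitzNear (fderiv ℝ (fderiv ℝ (φ ∘ e.symm))) x :=
  (LocallyLipschitzOn.lipschitzNear (hφ.regularity e he).2 (hφ.isOpen_chart e)
    ⟨hx, hxV⟩).fderiv_fderiv_of_iteratedFDeriv

lemma IsDefiningFunction.eventually_zero_iff {V' : Set M} {φ' : M → ℝ}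
    (hφ : IsDefiningFunction n N V φ) (hφ' : IsDefiningFunction n N V' φ')
    {x : EuclideanSpace ℝ (Fin n)}
    (hx : x ∈ e.target) (hxV : e.symm x ∈ V) (hxV' : e.symm x ∈ V') :
    ∀ᶠ z in 𝓝 x, (φ ∘ e.symm) z = 0 ↔ (φ' ∘ e.symm) z = 0 := by
  filter_upwards [(hφ.isOpen_chart e).mem_nhds ⟨hx, hxV⟩,
    (hφ'.isOpen_chart e).mem_nhds ⟨hx, hxV'⟩] with z hz hz'
  exact (hφ.zero_iff _ hz.2).symm.trans (hφ'.zero_iff _ hz'.2)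

variable [IsManifold (𝓡 n) ∞ M]

lemma IsDefiningFunction.mfderiv_eq (hφ : IsDefiningFunction n N V φ)
    (he : e ∈ atlas (EuclideanSpace ℝ (Fin n)) M) {p : M} (hp : p ∈ e.source) (hpV : p ∈ V)
    (v : TangentSpace (𝓡 n) p) : mfderiv (𝓡 n) 𝓘(ℝ, ℝ) φ p v =
      fderiv ℝ (φ ∘ e.symm) (e p) (mfderiv (𝓡 n) (𝓡 n) e p v) := by
  have h1 : φ =ᶠ[𝓝 p] (φ ∘ e.symm) ∘ e := by
    filter_upwards [e.open_source.mem_nhds hp] with z hz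
    simp [e.left_inv hz]
  have h2 : MDifferentiableAt (𝓡 n) 𝓘(ℝ, ℝ) (φ ∘ e.symm) (e p) :=
    ((hφ.contDiffAt he (e.map_source hp) (by rwa [e.left_inv hp])).differentiableAt
      (by simp)).mdifferentiableAt
  have h3 := mfderiv_comp p h2 ((mdifferentiable_atlas he).mdifferentiableAt hp)
  rw [mfderiv_eq_fderiv] at h3
  have h4 : mfderiv (𝓡 n) 𝓘(ℝ, ℝ) φ p v = mfderiv (𝓡 n) 𝓘(ℝ, ℝ) ((φ ∘ e.symm) ∘ e) p v :=
    congrArg (fun L : EuclideanSpace ℝ (Fin n) →L[ℝ] ℝ => L v) h1.mfderiv_eq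
  rw [h4]
  exact congrArg (fun L : EuclideanSpace ℝ (Fin n) →L[ℝ] ℝ => L v) h3

lemma IsDefiningFunction.fderiv_ne_zero (hφ : IsDefiningFunction n N V φ)
    (he : e ∈ atlas (EuclideanSpace ℝ (Fin n)) M) {x : EuclideanSpace ℝ (Fin n)}
    (hx : x ∈ e.target) (hxV : e.symm x ∈ V) (hxN : e.symm x ∈ N) :
    fderiv ℝ (φ ∘ e.symm) x ≠ 0 := by
  intro h
  refine hφ.regular _ ⟨hxV, hxN⟩ ?_
  ext v
  rw [hφ.mfderiv_eq he (e.map_target hx) hxV, e.right_inv hx, h]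
  rfl

/-- In a chart, the vectors tangent to `N` are in the kernel of the differential of each defining
function. -/
lemma IsDefiningFunction.fderiv_apply_eq_zero (hφ : IsDefiningFunction n N V φ)
    (he : e ∈ atlas (EuclideanSpace ℝ (Fin n)) M) {p : M} (hp : p ∈ e.source) (hpV : p ∈ V)
    (hpN : p ∈ N) {v : TangentSpace (𝓡 n) p} (hv : v ∈ hypersurfaceTangent N p) :
    fderiv ℝ (φ ∘ e.symm) (e p) (mfderiv (𝓡 n) (𝓡 n) e p v) = 0 := by
  obtain ⟨V', φ', hpV', hφ', h⟩ := hv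
  rw [hφ'.mfderiv_eq he hp hpV'] at h
  have hx := e.map_source hp
  have hs := e.left_inv hp
  refine fderiv_apply_eq_zero_of_zero_iff (f₁ := φ' ∘ e.symm)
    ((hφ'.contDiffAt he hx (hs.symm ▸ hpV')).of_le (by norm_num))
    ((hφ.contDiffAt he hx (hs.symm ▸ hpV)).of_le (by norm_num)) ?_
    (hφ'.fderiv_ne_zero he hx (hs.symm ▸ hpV') (hs.symm ▸ hpN))
    (hφ'.eventually_zero_iff hφ hx (hs.symm ▸ hpV') (hs.symm ▸ hpV)) h
  rw [Function.comp_apply, hs]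
  exact (hφ'.zero_iff p hpV').1 hpN

/-- Infinitesimal convexity in a chart, for an arbitrary defining function. -/
lemma IsInfinitesimallyConvexAt.hessian_nonpos (hF : IsRegularMetric F)
    (hφ : IsInnerDefiningFunction n N D V φ) (he : e ∈ atlas (EuclideanSpace ℝ (Fin n)) M)
    {x : EuclideanSpace ℝ (Fin n)} (hx : x ∈ e.target) (hxV : e.symm x ∈ V) (hxN : e.symm x ∈ N)
    (hconv : IsInfinitesimallyConvexAt F N D (e.symm x)) {y : EuclideanSpace ℝ (Fin n)}
    (hy : fderiv ℝ (φ ∘ e.symm) x y = 0) :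
    fderiv ℝ (fderiv ℝ (φ ∘ e.symm)) x y y - fderiv ℝ (φ ∘ e.symm) x (spray F e x y) ≤ 0 := by
  rcases eq_or_ne y 0 with rfl | hy0
  · simp [hF.spray_zero]
  obtain ⟨V', φ', hxV', hφ', hH⟩ := hconv
  have hxe : e.symm x ∈ e.source := e.map_target hx
  set v : TangentSpace (𝓡 n) (e.symm x) := mfderiv (𝓡 n) (𝓡 n) e.symm x y
  have hev : mfderiv (𝓡 n) (𝓡 n) e (e.symm x) v = y := mfderiv_mfderiv_symm he hx y
  have hvT : v ∈ hypersurfaceTangent N (e.symm x) := by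
    refine ⟨V, φ, hxV, hφ.defining, ?_⟩
    rw [hφ.defining.mfderiv_eq he hxe hxV, hev, e.right_inv hx, hy]
    rfl
  have hv0 : v ≠ 0 := by
    intro h
    rw [h] at hev
    exact hy0 (hev.symm.trans (map_zero (mfderiv (𝓡 n) (𝓡 n) e (e.symm x))))
  have h1 := hH v hvT hv0 e he hxe
  have h2 : fderiv ℝ (fderiv ℝ (φ' ∘ e.symm)) x y y +
      fderiv ℝ (φ' ∘ e.symm) x (-spray F e x y) ≤ 0 := by
    rw [map_neg, ← sub_eq_add_neg]
    unfold hessian at h1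
    rw [hev, e.right_inv hx] at h1
    exact h1
  have h3 := hφ'.defining.fderiv_apply_eq_zero he hxe hxV' hxN hvT
  rw [hev, e.right_inv hx] at h3
  have h4 : ∀ᶠ z in 𝓝 x, 0 < (φ' ∘ e.symm) z ↔ 0 < (φ ∘ e.symm) z := by
    filter_upwards [(hφ.defining.isOpen_chart e).mem_nhds ⟨hx, hxV⟩,
      (hφ'.defining.isOpen_chart e).mem_nhds ⟨hx, hxV'⟩] with z hz hz'
    exact (hφ'.pos_iff _ hz'.2).symm.trans (hφ.pos_iff _ hz.2)
  have h5 := second_deriv_nonpos_of_pos_iff (hφ'.defining.contDiffAt he hx hxV')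
    (hφ.defining.contDiffAt he hx hxV) ((hφ'.defining.zero_iff _ hxV').1 hxN)
    ((hφ.defining.zero_iff _ hxV).1 hxN) (hφ'.defining.fderiv_ne_zero he hx hxV' hxN) h4 h3 hy h2
  rwa [map_neg, ← sub_eq_add_neg] at h5

/-! ### Local convexity -/

/-- The half of local convexity that concerns the exponential map of `F` itself. -/
lemma IsRegularMetric.exists_expMap_notMem [T2Space M] (hF : IsRegularMetric F) {U : Set M}
    (hU : IsOpen U) (hD : IsInnerDomain n N U D)
    (hconv : ∀ x ∈ U ∩ N, IsInfinitesimallyConvexAt F N D x) {q : M} (hq : q ∈ U ∩ N) :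
    ∃ W ∈ 𝓝 (0 : TangentSpace (𝓡 n) q), W ⊆ expDomain F q ∧
      ∀ v ∈ W ∩ hypersurfaceTangent N q, expMap F q v ∉ D := by
  obtain ⟨V, φ, hqV, hφ⟩ := hD q hq
  set e := chartAt (EuclideanSpace ℝ (Fin n)) q with he_def
  have he : e ∈ atlas (EuclideanSpace ℝ (Fin n)) M := chart_mem_atlas _ q
  have hqe : q ∈ e.source := mem_chart_source _ q
  have hx₀ : e q ∈ e.target := e.map_source hqe
  have hsymm : e.symm (e q) = q := e.left_inv hqe
  set f := φ ∘ e.symm with hf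
  set x₀ := e q with hx₀_def
  have hVx₀ : e.symm x₀ ∈ V := hsymm.symm ▸ hqV
  have hNx₀ : e.symm x₀ ∈ N := hsymm.symm ▸ hq.2
  have hf2 : ContDiffAt ℝ 2 f x₀ := hφ.defining.contDiffAt he hx₀ hVx₀
  have hf0 : f x₀ = 0 := (hφ.defining.zero_iff _ hVx₀).1 hNx₀
  have hreg : fderiv ℝ f x₀ ≠ 0 := hφ.defining.fderiv_ne_zero he hx₀ hVx₀ hNx₀
  set H : EuclideanSpace ℝ (Fin n) × EuclideanSpace ℝ (Fin n) → ℝ := fun z =>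
    fderiv ℝ (fderiv ℝ f) z.1 z.2 z.2 - fderiv ℝ f z.1 (spray F e z.1 z.2) with hH
  have hspray := hF.lipschitzNear_spray he hx₀ 0
  have hHl : LipschitzNear H (x₀, 0) := by
    have h1 : LipschitzNear (fun z : EuclideanSpace ℝ (Fin n) × EuclideanSpace ℝ (Fin n) =>
        fderiv ℝ (fderiv ℝ f) z.1) (x₀, 0) :=
      LipschitzNear.comp (f := Prod.fst) (x := (x₀, (0 : EuclideanSpace ℝ (Fin n))))
        (hφ.defining.lipschitzNear_fderiv_fderiv he hx₀ hVx₀) contDiff_fst.contDiffAt.lipschitzNear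
    have h2 : LipschitzNear (fun z : EuclideanSpace ℝ (Fin n) × EuclideanSpace ℝ (Fin n) =>
        fderiv ℝ f z.1) (x₀, 0) :=
      LipschitzNear.comp (f := Prod.fst) (x := (x₀, (0 : EuclideanSpace ℝ (Fin n))))
        (hf2.fderiv_right (m := 1) (by norm_num)).lipschitzNear
        contDiff_fst.contDiffAt.lipschitzNear
    have h3 : LipschitzNear (fun z : EuclideanSpace ℝ (Fin n) × EuclideanSpace ℝ (Fin n) => z.2)
        (x₀, 0) := contDiff_snd.contDiffAt.lipschitzNear
    exact ((h1.clm_apply h3).clm_apply h3).sub (h2.clm_apply hspray)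
  have hUV : IsOpen (e.target ∩ e.symm ⁻¹' (V ∩ U)) :=
    e.isOpen_inter_preimage_symm (hφ.defining.isOpen.inter hU)
  have hUVx₀ : e.target ∩ e.symm ⁻¹' (V ∩ U) ∈ 𝓝 x₀ :=
    hUV.mem_nhds ⟨hx₀, hVx₀, hsymm.symm ▸ hq.1⟩
  have hneg : ∀ᶠ x in 𝓝 x₀, f x = 0 → ∀ y, fderiv ℝ f x y = 0 → H (x, y) ≤ 0 := by
    filter_upwards [hUVx₀] with x hx hfx y hy
    have hxN : e.symm x ∈ N := (hφ.defining.zero_iff _ hx.2.1).2 hfx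
    exact (hconv _ ⟨hx.2.2, hxN⟩).hessian_nonpos hF hφ he hx.1 hx.2.1 hxN hy
  obtain ⟨C, hC, hHC⟩ := eventually_le_of_nonpos_on_tangent hf2 hf0 hreg hHl hneg
  set X : EuclideanSpace ℝ (Fin n) × EuclideanSpace ℝ (Fin n) →
      EuclideanSpace ℝ (Fin n) × EuclideanSpace ℝ (Fin n) :=
    fun z => (z.2, -spray F e z.1 z.2) with hX
  have hXl : LipschitzNear X (x₀, 0) :=
    LipschitzNear.prodMk contDiff_snd.contDiffAt.lipschitzNear hspray.neg
  obtain ⟨ε, hε, r, hr, hflow⟩ := hXl.exists_integralCurve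
    (hHC.and (continuousAt_fst.eventually hUVx₀))
  -- a time within the reach of the flow and short enough for the differential inequality
  set δ := min (ε / 2) (1 / (2 * (C + 1))) with hδ
  have hδ0 : 0 < δ := by positivity
  have hδε : δ * 2 ≤ ε := by linarith [min_le_left (ε / 2) (1 / (2 * (C + 1)))]
  have hδC : C * δ * (1 + δ) < 1 := by
    have h1 : δ * (2 * (C + 1)) ≤ 1 := by
      have := min_le_right (ε / 2) (1 / (2 * (C + 1)))
      rwa [← hδ, le_div_iff₀ (by positivity)] at this
    have h2 : 0 ≤ C * δ := by positivity
    nlinarith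
  set A : TangentSpace (𝓡 n) q →L[ℝ] EuclideanSpace ℝ (Fin n) := mfderiv (𝓡 n) (𝓡 n) e q with hA
  -- for `‖A v‖ ≤ r δ`, the geodesic with initial velocity `v` is a slowed-down integral curve of
  -- the flow, which passes through time `[0, δ]` while the geodesic passes through `[0, 1]`
  have hgeo : ∀ v : TangentSpace (𝓡 n) q, ‖A v‖ ≤ r * δ → ∃ γ : ℝ → M,
      IsUnitTimeGeodesic F q v γ ∧ (∀ t ∈ Icc (0 : ℝ) 1, γ t ∈ e.source) ∧
      (fderiv ℝ f x₀ (A v) = 0 → γ 1 ∉ D) := by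
    intro v hv
    have hw : (x₀, δ⁻¹ • A v) ∈
        Metric.closedBall (x₀, (0 : EuclideanSpace ℝ (Fin n))) r := by
      rw [Metric.mem_closedBall, Prod.dist_eq, dist_self, dist_zero_right, norm_smul,
        Real.norm_eq_abs, abs_of_pos (by positivity)]
      refine max_le hr.le ?_
      rw [inv_mul_le_iff₀ hδ0]
      linarith
    obtain ⟨α, hα0, hα⟩ := hflow _ hw
    have hscale : ∀ s ∈ Ioo (-2 : ℝ) 2, δ * s ∈ Ioo (-ε) ε := fun s hs =>
      ⟨by nlinarith [hs.1], by nlinarith [hs.2]⟩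
    have hα₁ : ∀ t ∈ Ioo (-ε) ε, HasDerivAt (fun t => (α t).1) (α t).2 t := fun t ht =>
      (hα t ht).1.fst
    have hα₂ : ∀ t ∈ Ioo (-ε) ε,
        HasDerivAt (fun t => (α t).2) (-spray F e (α t).1 (α t).2) t := fun t ht =>
      (hα t ht).1.snd
    have hα₀₁ : (α 0).1 = x₀ := by rw [hα0]
    have hα₀₂ : (α 0).2 = δ⁻¹ • A v := by rw [hα0]
    have hlin : ∀ s : ℝ, HasDerivAt (fun s => δ * s) δ s := fun s => by
      simpa using (hasDerivAt_id s).const_mul δ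
    set c : ℝ → EuclideanSpace ℝ (Fin n) := fun s => (α (δ * s)).1 with hc
    set y : ℝ → EuclideanSpace ℝ (Fin n) := fun s => δ • (α (δ * s)).2 with hy
    have hcd : ∀ s ∈ Ioo (-2 : ℝ) 2, HasDerivAt c (y s) s := fun s hs =>
      HasDerivAt.scomp (g₁ := fun t => (α t).1) s (hα₁ _ (hscale s hs)) (hlin s)
    have hyd : ∀ s ∈ Ioo (-2 : ℝ) 2, HasDerivAt y (-spray F e (c s) (y s)) s := fun s hs => by
      have h1 := (HasDerivAt.scomp (g₁ := fun t => (α t).2) s (hα₂ _ (hscale s hs))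
        (hlin s)).const_smul δ
      refine h1.congr_deriv ?_
      rw [hF.spray_smul _ _ hδ0, smul_neg, smul_neg, smul_smul, ← pow_two]
    have hct : ∀ s ∈ Ioo (-2 : ℝ) 2, c s ∈ e.target := fun s hs =>
      (hα _ (hscale s hs)).2.2.1
    have hγ : IsGeodesicOn F (e.symm ∘ c) (Ioo (-2) 2) :=
      hF.isGeodesicOn_of_hasDerivAt he isOpen_Ioo hct hcd hyd
    have h0mem : (0 : ℝ) ∈ Ioo (-2 : ℝ) 2 := by norm_num
    have h1mem : (1 : ℝ) ∈ Ioo (-2 : ℝ) 2 := by norm_num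
    have hc0 : c 0 = x₀ := by simp only [hc, mul_zero, hα₀₁]
    have hγ0 : (e.symm ∘ c) 0 = q := by rw [Function.comp_apply, hc0, hsymm]
    have hvel : (mfderiv 𝓘(ℝ, ℝ) (𝓡 n) (e.symm ∘ c) 0 (1 : ℝ) : EuclideanSpace ℝ (Fin n)) = v := by
      have h1 : MDifferentiableAt 𝓘(ℝ, ℝ) (𝓡 n) c 0 :=
        (hcd 0 h0mem).differentiableAt.mdifferentiableAt
      have h2 := mfderiv_comp 0 ((mdifferentiable_atlas he).mdifferentiableAt_symm (hct 0 h0mem)) h1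
      rw [mfderiv_eq_fderiv] at h2
      have h3 : fderiv ℝ c 0 1 = A v := by
        rw [(hcd 0 h0mem).hasFDerivAt.fderiv]
        simp [hy, hα₀₂, smul_smul, hδ0.ne']
      have h4 : (mfderiv 𝓘(ℝ, ℝ) (𝓡 n) (e.symm ∘ c) 0 (1 : ℝ) : EuclideanSpace ℝ (Fin n)) =
          mfderiv (𝓡 n) (𝓡 n) e.symm (c 0) (fderiv ℝ c 0 1) :=
        congrArg (fun L : ℝ →L[ℝ] EuclideanSpace ℝ (Fin n) => L 1) h2
      rw [h4, h3, hc0]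
      exact mfderiv_symm_mfderiv he hqe v
    refine ⟨e.symm ∘ c, ⟨⟨-2, 2, by norm_num, by norm_num, hγ⟩, hγ0, hvel⟩, ?_, ?_⟩
    · intro t ht
      exact e.map_target (hct t ⟨by linarith [ht.1], by linarith [ht.2]⟩)
    · intro htan
      have hsub : Icc 0 δ ⊆ Ioo (-ε) ε := fun t ht => ⟨by linarith [ht.1], by linarith [ht.2]⟩
      have hfd : ∀ t ∈ Icc 0 δ, ContDiffAt ℝ 2 f (α t).1 := fun t ht =>
        hφ.defining.contDiffAt he (hα t (hsub ht)).2.2.1 (hα t (hsub ht)).2.2.2.1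
      have hle := nonpos_of_deriv_deriv_le (u := fun t => f (α t).1)
        (v := fun t => fderiv ℝ f (α t).1 (α t).2) (a := fun t => H (α t)) hC hδC
        (fun t ht => ((hfd t ht).differentiableAt (by simp)).hasFDerivAt.comp_hasDerivAt t
          (hα₁ t (hsub ht)))
        (fun t ht => by
          have h1 : HasDerivAt (fun t => fderiv ℝ f (α t).1)
              (fderiv ℝ (fderiv ℝ f) (α t).1 (α t).2) t :=
            (((hfd t ht).fderiv_right (m := 1) (by norm_num)).differentiableAt
              (by simp)).hasFDerivAt.comp_hasDerivAt t (hα₁ t (hsub ht))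
          refine (h1.clm_apply (hα₂ t (hsub ht))).congr_deriv ?_
          rw [map_neg, ← sub_eq_add_neg])
        (fun t ht => (hα t (hsub ht)).2.1) (by simp only [hα₀₁, hf0])
        (by simp only [hα₀₁, hα₀₂, map_smul, htan, smul_zero]) δ ⟨hδ0.le, le_rfl⟩
      have hV1 : e.symm (c 1) ∈ V := (hα _ (hscale 1 h1mem)).2.2.2.1
      intro hDmem
      have hpos := (hφ.pos_iff _ hV1).1 hDmem
      simp only [hc, mul_one] at hpos
      exact absurd hle (not_le.2 hpos)
  have hW : {v : TangentSpace (𝓡 n) q | ‖A v‖ ≤ r * δ} ∈ 𝓝 (0 : TangentSpace (𝓡 n) q) := by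
    have h1 : Metric.closedBall (0 : EuclideanSpace ℝ (Fin n)) (r * δ) ∈ 𝓝 (A 0) := by
      rw [map_zero]
      exact Metric.closedBall_mem_nhds _ (by positivity)
    filter_upwards [A.continuous.continuousAt h1] with v hv
    simpa using hv
  refine ⟨_, hW, fun v hv => ?_, fun v hv => ?_⟩
  · obtain ⟨γ, hγ, -⟩ := hgeo v hv
    exact ⟨γ, hγ⟩
  · obtain ⟨γ, hγ, hsrc, hnot⟩ := hgeo v hv.1
    have hex : ∃ γ : ℝ → M, IsUnitTimeGeodesic F q v γ := ⟨γ, hγ⟩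
    have hexp : expMap F q v = hex.choose 1 := dif_pos hex
    have hγ' := hex.choose_spec
    set γ' := hex.choose with hγ'_def
    rw [hexp]
    obtain ⟨⟨a, b, ha, hb, hg⟩, h0, hv0⟩ := hγ
    obtain ⟨⟨a', b', ha', hb', hg'⟩, h0', hv0'⟩ := hγ'
    have hJ₁ := hg.mono (J' := Ioo (max a a') (min b b'))
      (Ioo_subset_Ioo (le_max_left _ _) (min_le_left _ _))
    have hJ₂ := hg'.mono (J' := Ioo (max a a') (min b b'))
      (Ioo_subset_Ioo (le_max_right _ _) (min_le_right _ _))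
    have hmax : max a a' < 0 := max_lt ha ha'
    have hmin : 1 < min b b' := lt_min hb hb'
    have hvel : ∀ {γ : ℝ → M}, IsGeodesicOn F γ (Ioo (max a a') (min b b')) → γ 0 = q →
        (mfderiv 𝓘(ℝ, ℝ) (𝓡 n) γ 0 (1 : ℝ) : EuclideanSpace ℝ (Fin n)) = v →
        deriv (e ∘ γ) 0 = A v := by
      intro γ hγ hγ0 hγv
      have h1 := hγ.deriv_eq he (s := 0) ⟨hmax, by linarith⟩ (hγ0 ▸ hqe)
      rw [h1]
      have h2 : ∀ p, p = q → ∀ u : EuclideanSpace ℝ (Fin n),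
          (mfderiv (𝓡 n) (𝓡 n) e p u : EuclideanSpace ℝ (Fin n)) = A u := by
        rintro _ rfl _; rfl
      exact (h2 _ hγ0 _).trans (congrArg A hγv)
    have huniq := hF.geodesic_unique he isOpen_Ioo hJ₁ hJ₂ zero_le_one
      (fun t ht => ⟨by linarith [ht.1], by linarith [ht.2]⟩) hsrc (h0.trans h0'.symm)
      ((hvel hJ₁ h0 hv0).trans (hvel hJ₂ h0' hv0').symm)
    rw [← huniq]
    exact hnot (hφ.defining.fderiv_apply_eq_zero he hqe hqV hq.2 hv.2)

end Hypersurface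

end Finsler

theorem mainTheorem1 {n : ℕ} {M : Type*} [TopologicalSpace M] [T2Space M]
    [ChartedSpace (EuclideanSpace ℝ (Fin n)) M] [IsManifold (𝓡 n) ∞ M]
    (F : (x : M) → TangentSpace (𝓡 n) x → ℝ) (hF : Finsler.IsFinslerMetric F)
    (hF' : Finsler.HasC11FundamentalTensor F)
    (N : Set M) (hN : Finsler.IsC21Hypersurface n N)
    (p : M) (hp : p ∈ N) (U : Set M) (hU : IsOpen U) (hpU : p ∈ U)
    (D : Set M) (hD : Finsler.IsInnerDomain n N U D)
    (hconv : ∀ x ∈ U ∩ N, Finsler.IsInfinitesimallyConvexAt F N D x) :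
    Finsler.IsLocallyConvexAt F N D p ∧
      ∀ q ∈ U ∩ N, Finsler.IsLocallyConvexAt F N D q := by
  have hreg := hF.isRegularMetric hF'
  have key : ∀ q ∈ U ∩ N, Finsler.IsLocallyConvexAt F N D q := by
    intro q hq
    obtain ⟨W₁, hW₁, hdom₁, hexp₁⟩ := hreg.exists_expMap_notMem hU hD hconv hq
    obtain ⟨W₂, hW₂, hdom₂, hexp₂⟩ := hreg.reversed.exists_expMap_notMem hU hD
      (fun x hx => (hconv x hx).reversed) hq
    exact ⟨W₁ ∩ W₂, inter_mem hW₁ hW₂, inter_subset_left.trans hdom₁,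
      inter_subset_right.trans hdom₂,
      fun v hv => ⟨hexp₁ v ⟨hv.1.1, hv.2⟩, hexp₂ v ⟨hv.1.2, hv.2⟩⟩⟩
  exact ⟨key p ⟨hpU, hp⟩, key⟩
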